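/- Let $m\ge 1$, $A\in\mathbb{Q}^{m\times n}$ with no zero row, $b\in\mathbb{Q}^m$, let $a_1^T,\dots,a_m^T$ be the rows of $A$, and suppose that $\mathcal X=\{x\in\mathbb{R}^n : Ax\le b\}$ is nonempty. For a rational $r=p/d$ in lowest terms ($d\geq 1$) put $\ell(r)=\log_2(|p|+1)+\log_2 d$ (so $\ell(r)=\log_2(|r|+1)$ for an integer $r$), and let the binary encoding length of the system be $$\sigma=\sum_{i,j}\ell(a_{ij})+\sum_i \ell(b_i)+\log_2(mn)+2 .$$ Put $\theta(x)=\max_i (a_i^Tx-b_i)^+$. A point $x$ is a *certificate of feasibility* if $\theta(x)<2^{1-\sigma}$. **Sketches and sampling rules.** Let $B\in\mathbb{R}^{n\times n}$ be symmetric positive definite, $\langle x,y\rangle_B=x^TBy$, $\|x\|_B=\sqrt{x^TBx}$, $d_B(x,\mathcal X)=\inf_{y\in\mathcal X}\|y-x\|_B$, and let $S_1,\dots,S_q\in\mathbb{R}^m_{+}$ with $A^TS_i\neq 0$. Put $$f_i(x)=\frac{\big([S_i^T(Ax-b)]^+\big)^2}{2\|A^TS_i\|_{B^{-1}}^2},\qquad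 \nabla^Bf_i(x)=\frac{[S_i^T(Ax-b)]^+}{\|A^TS_i\|_{B^{-1}}^2}\,B^{-1}A^TS_i .$$ A sampling rule $\mathcal R$ assigns to each $x\in\mathbb{R}^n$ a probability distribution on $\{1,\dots,q\}$; put $f(x)=\mathbb{E}[f_i(x)\mid i\sim\mathcal R]$. Let $\mu_1>0$ and $\mu_2$ be any constants with $$\tfrac{\mu_1}{2}d_B(x,\mathcal X)^2\le f(x)\le\tfrac{\mu_2}{2}d_B(x,\mathcal X)^2\quad\text{for all }x\in\mathbb{R}^n .$$ **Algorithm (ASPM).** $x_1=x_0=0$ and $x_{k+1}=x_k-\delta\nabla^Bf_{i}(x_k)+\gamma(x_k-x_{k-1})$ for $k\ge1$, where $i=i_k$ is drawn, given the past, from the distribution that $\mathcal R$ assigns to $x_k$. **Parameters.** Let $h(\delta)=1-(2\delta-\delta^2)\mu_1$ and $$Q=\Big\{(\delta,\gamma): 0<\delta<2,\ 0\le\gamma<\tfrac{1-\sqrt{h(\delta)}}{1-\sqrt{h(\delta)}+\delta\sqrt{\mu_2}}\Big\},\qquad R=\Big\{(\delta,\gamma,\zeta): 0<\delta<2,\ \zeta\ge0,\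 0\le\gamma<\tfrac{\zeta}{1+\zeta}\Big\},$$ $$S=\Big\{(\delta,\gamma,\zeta): \tfrac{\gamma\mu_2}{\mu_1}<\tfrac{2}{1+\zeta}-\delta+\gamma\le\tfrac{1+\gamma}{\delta\mu_1(1+\zeta)}\Big\}.$$ Put $\rho_2=\tfrac12\Big[\sqrt{h(\delta)}+\gamma+\sqrt{(\sqrt{h(\delta)}-\gamma)^2+4\gamma\delta\sqrt{\mu_2}}\Big]$ and $$\beta_1=1+\gamma+\delta\mu_1[(1+\zeta)(\delta-\gamma)-2],\qquad \beta_2=\gamma[\delta(1+\zeta)\mu_2-1],\qquad \beta_3=\zeta\gamma^2+\gamma^2+\gamma .$$ If $\delta\mu_2(1+\zeta)\le1$ put $\alpha^*=\max\{0,\tfrac{\beta_3}{\zeta}-\beta_1-\beta_2\}$ and $\rho=\max\{\beta_1+\beta_2,\tfrac{\beta_3}{\zeta}\}$. Otherwise put $$\alpha^*=\max\Big\{0,\tfrac{\beta_3}{\zeta}-\beta_1,\tfrac{-\beta_1+\sqrt{\beta_1^2+4\beta_2}}{2}\Big\},\qquad \rho=\max\Big\{\tfrac{\beta_3}{\zeta},\tfrac{\beta_1+\sqrt{\beta_1^2+4\beta_2}}{2}\Big\}.$$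 Assume that one of the following holds, and define $\alpha$ and $\bar\rho$ accordingly: 1. $(\delta,\gamma)\in Q$; then $\alpha=0$ and $\bar\rho=\rho_2^2$. 2. $(\delta,\gamma,\zeta)\in R\cap S$, and either $\mathcal R$ draws a nonempty index set from a fixed distribution and then chooses in it an index maximizing $f_i(x)$ with ties broken arbitrarily (this includes all fixed-probability rules, maximum distance sampling, and greedy sampling from uniform $\tau$-subsets), or, more generally, $f$ is convex with $\mathbb{E}[\nabla^Bf_i(x)\mid i\sim\mathcal R]$ as a subgradient with respect to $\langle\cdot,\cdot\rangle_B$, i.e. $f(y)\ge f(x)+\langle \mathbb{E}[\nabla^Bf_i(x)\mid i\sim\mathcal R],y-x\rangle_B$ for all $x,y$; then $\alpha=\alpha^*$ and $\bar\rho=\rho$. 3. $(\delta,\gamma)\in Q$ and $(\delta,\gamma,\zeta)\in R\cap S$; then $\alpha=\alpha^*$ and $\bar\rho=\max\{\rho_2^2,\rho\}$. **Conclusion.** Let $\psi=\max_j\|a_j\|_2$ and $\xi=\lambda_{\max}(B)/\lambda_{\min}(B)$. Then $\alpha\ge0$ and $0\le\bar\rho<1$. For every $k\in\mathbb{N}$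 with $$\frac{4\sigma-4-\log_2 n+\log_2(1+\alpha)+\log_2\xi+2\log_2\psi}{\log_2(1/\bar\rho)}<k-1$$ (the left side is read as $0$ if $\bar\rho=0$), the probability $p$ that $x_k$ is not a certificate of feasibility satisfies $$p\le H(k)=\sqrt{\frac{\xi(1+\alpha)}{n}}\;\psi\;2^{2\sigma-2}\;\bar\rho^{\frac{k-1}{2}} .$$ Moreover $H$ is nonincreasing in $k\ge1$, and strictly decreasing in $k$ if $\bar\rho>0$. -/

import Mathlib

open scoped Matrix

noncomputable section

namespace ASPM

/-! ### The linear system and its binary encoding length -/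

/-- A rational matrix, seen as a real one. -/
def realMat {m n : ℕ} (A : Matrix (Fin m) (Fin n) ℚ) : Matrix (Fin m) (Fin n) ℝ :=
  A.map (fun a => (a : ℝ))

/-- A rational vector, seen as a real one. -/
def realVec {m : ℕ} (b : Fin m → ℚ) : Fin m → ℝ := fun i => (b i : ℝ)

/-- The number of bits of `p / q` in lowest terms; for an integer `p` it is `log₂ (|p| + 1)`. -/
def ratBits (r : ℚ) : ℝ := Real.logb 2 (|(r.num : ℝ)| + 1) + Real.logb 2 (r.den : ℝ)

/-- Binary encoding length of the rational system `A x ≤ b`. -/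
def encodingLength {m n : ℕ} (A : Matrix (Fin m) (Fin n) ℚ) (b : Fin m → ℚ) : ℝ :=
  (∑ i, ∑ j, ratBits (A i j)) + (∑ i, ratBits (b i)) + Real.logb 2 ((m : ℝ) * (n : ℝ)) + 2

/-- The feasible region `{x | A x ≤ b}` (componentwise). -/
def feasible {m n : ℕ} (A : Matrix (Fin m) (Fin n) ℝ) (b : Fin m → ℝ) : Set (Fin n → ℝ) :=
  {x | ∀ i, (A *ᵥ x) i ≤ b i}

/-- The maximum violation `max_i (a_iᵀ x - b_i)⁺`. -/
def maxViolation {m n : ℕ} (A : Matrix (Fin m) (Fin n) ℝ) (b : Fin m → ℝ) (x : Fin n → ℝ) : ℝ :=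
  ⨆ i, max ((A *ᵥ x) i - b i) 0

/-- `x` is a certificate of feasibility when its maximum violation is below `2 ^ (1 - σ)`. -/
def IsCertificate {m n : ℕ} (A : Matrix (Fin m) (Fin n) ℚ) (b : Fin m → ℚ) (x : Fin n → ℝ) :
    Prop :=
  maxViolation (realMat A) (realVec b) x < (2 : ℝ) ^ (1 - encodingLength A b)

/-- The largest Euclidean length of a row of `A`. -/
def maxRowNorm {m n : ℕ} (A : Matrix (Fin m) (Fin n) ℝ) : ℝ :=
  ⨆ j, Real.sqrt (∑ l, A j l ^ 2)

/-! ### The geometry of a positive definite matrix `B` -/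

/-- `λ_max(B) / λ_min(B)`; for symmetric `B` the real spectrum is the set of all eigenvalues. -/
def condNumber {n : ℕ} (B : Matrix (Fin n) (Fin n) ℝ) : ℝ :=
  sSup (spectrum ℝ B) / sInf (spectrum ℝ B)

/-- `⟨x, y⟩_B = xᵀ B y`. -/
def bInner {n : ℕ} (B : Matrix (Fin n) (Fin n) ℝ) (x y : Fin n → ℝ) : ℝ := x ⬝ᵥ (B *ᵥ y)

/-- `‖x‖_B = √(xᵀ B x)`. -/
def bNorm {n : ℕ} (B : Matrix (Fin n) (Fin n) ℝ) (x : Fin n → ℝ) : ℝ := Real.sqrt (bInner B x x)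

/-- `d_B(x, X) = inf_{y ∈ X} ‖y - x‖_B`. -/
def bDist {n : ℕ} (B : Matrix (Fin n) (Fin n) ℝ) (x : Fin n → ℝ) (X : Set (Fin n → ℝ)) : ℝ :=
  sInf ((fun y => bNorm B (y - x)) '' X)

/-! ### Sketched losses and sampling rules -/

section Sketch

variable {m n q : ℕ} (A : Matrix (Fin m) (Fin n) ℝ) (b : Fin m → ℝ)
  (B : Matrix (Fin n) (Fin n) ℝ) (S : Fin q → Fin m → ℝ)

/-- `[S_iᵀ (A x - b)]⁺`. -/
def sketchResidual (i : Fin q) (x : Fin n → ℝ) : ℝ := max (S i ⬝ᵥ (A *ᵥ x - b)) 0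

/-- `‖Aᵀ S_i‖²` in the `B⁻¹`-norm. -/
def sketchScale (i : Fin q) : ℝ := bInner B⁻¹ (Aᵀ *ᵥ S i) (Aᵀ *ᵥ S i)

/-- The sketched loss `f_i`. -/
def sketchLoss (i : Fin q) (x : Fin n → ℝ) : ℝ :=
  sketchResidual A b S i x ^ 2 / (2 * sketchScale A B S i)

/-- The gradient `∇^B f_i` with respect to the `B`-inner product. -/
def sketchGrad (i : Fin q) (x : Fin n → ℝ) : Fin n → ℝ :=
  (sketchResidual A b S i x / sketchScale A B S i) • (B⁻¹ *ᵥ (Aᵀ *ᵥ S i))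

/-- An adaptive sampling rule: given the current iterate, a law of the next sketch index. -/
abbrev SamplingRule (n q : ℕ) : Type := (Fin n → ℝ) → PMF (Fin q)

/-- `f(x) = E[f_i(x) | i ∼ R]`. -/
def expLoss (R : SamplingRule n q) (x : Fin n → ℝ) : ℝ :=
  ∑ i, (R x i).toReal * sketchLoss A b B S i x

/-- `E[∇^B f_i(x) | i ∼ R]`. -/
def expGrad (R : SamplingRule n q) (x : Fin n → ℝ) : Fin n → ℝ :=
  ∑ i, (R x i).toReal • sketchGrad A b B S i x

/-- Greedy sketched loss sampling: draw a nonempty set `φ` of indices from a fixed law, then choose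
a maximiser of `f_i(x)` over `i ∈ φ` (ties broken in any way, possibly at random). Uniform
`τ`-subsets give the rule `G(τ)`; singletons give all fixed-probability rules. -/
def IsGreedyRule (R : SamplingRule n q) : Prop :=
  ∃ (ν : PMF (Finset (Fin q))) (c : (Fin n → ℝ) → Finset (Fin q) → PMF (Fin q)),
    (∀ φ ∈ ν.support, φ.Nonempty) ∧
    (∀ x, ∀ φ ∈ ν.support, ∀ i ∈ (c x φ).support,
      i ∈ φ ∧ ∀ j ∈ φ, sketchLoss A b B S j x ≤ sketchLoss A b B S i x) ∧
    ∀ x, R x = ν.bind (c x)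

/-- `f` is convex with the expected gradient of the rule as a (sub)gradient, in the `B`-inner
product. -/
def IsConvexRule (R : SamplingRule n q) : Prop :=
  ∀ x y, expLoss A b B S R x + bInner B (expGrad A b B S R x) (y - x) ≤ expLoss A b B S R y

/-! ### The momentum algorithm -/

/-- From `(x_{k-1}, x_k)` to `(x_k, x_{k+1})` when index `i` is selected. -/
def step (δ γ : ℝ) (i : Fin q) (s : (Fin n → ℝ) × (Fin n → ℝ)) : (Fin n → ℝ) × (Fin n → ℝ) :=
  (s.2, s.2 - δ • sketchGrad A b B S i s.2 + γ • (s.2 - s.1))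

/-- The law of `(x_k, x_{k+1})` when the algorithm starts from `x_1 = x_0`. -/
def pairLaw (R : SamplingRule n q) (δ γ : ℝ) (x₀ : Fin n → ℝ) :
    ℕ → PMF ((Fin n → ℝ) × (Fin n → ℝ))
  | 0 => PMF.pure (x₀, x₀)
  | k + 1 => (pairLaw R δ γ x₀ k).bind fun s => (R s.2).map fun i => step A b B S δ γ i s

/-- The law of the iterate `x_k`. -/
def iterateLaw (R : SamplingRule n q) (δ γ : ℝ) (x₀ : Fin n → ℝ) (k : ℕ) : PMF (Fin n → ℝ) :=
  (pairLaw A b B S R δ γ x₀ k).map Prod.fst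

end Sketch

/-- The probability that the iterate `x_k`, started from `x_0 = 0`, is not a certificate of
feasibility. -/
def failProb {m n q : ℕ} (A : Matrix (Fin m) (Fin n) ℚ) (b : Fin m → ℚ)
    (B : Matrix (Fin n) (Fin n) ℝ) (S : Fin q → Fin m → ℝ) (R : SamplingRule n q)
    (δ γ : ℝ) (k : ℕ) : ℝ :=
  ((iterateLaw (realMat A) (realVec b) B S R δ γ 0 k).toOuterMeasure
    {x | ¬ IsCertificate A b x}).toReal

/-! ### Parameter sets and rates -/

/-- `h(δ) = 1 - (2 δ - δ²) μ₁`. -/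
def hR (μ₁ δ : ℝ) : ℝ := 1 - (2 * δ - δ ^ 2) * μ₁

def setQ (μ₁ μ₂ : ℝ) : Set (ℝ × ℝ) :=
  {p | 0 < p.1 ∧ p.1 < 2 ∧ 0 ≤ p.2 ∧
    p.2 < (1 - √(hR μ₁ p.1)) / (1 - √(hR μ₁ p.1) + p.1 * √μ₂)}

def setR : Set (ℝ × ℝ × ℝ) :=
  {p | 0 < p.1 ∧ p.1 < 2 ∧ 0 ≤ p.2.2 ∧ 0 ≤ p.2.1 ∧ p.2.1 < p.2.2 / (1 + p.2.2)}

def setS (μ₁ μ₂ : ℝ) : Set (ℝ × ℝ × ℝ) :=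
  {p | p.2.1 * μ₂ / μ₁ < 2 / (1 + p.2.2) - p.1 + p.2.1 ∧
    2 / (1 + p.2.2) - p.1 + p.2.1 ≤ (1 + p.2.1) / (p.1 * μ₁ * (1 + p.2.2))}

/-- The larger eigenvalue of the matrix with rows `(√h(δ), γ)` and `(δ √μ₂, γ)`. -/
def rho2 (μ₁ μ₂ δ γ : ℝ) : ℝ :=
  (√(hR μ₁ δ) + γ + √((√(hR μ₁ δ) - γ) ^ 2 + 4 * γ * (δ * √μ₂))) / 2

def beta1 (μ₁ δ γ ζ : ℝ) : ℝ := 1 + γ + δ * μ₁ * ((1 + ζ) * (δ - γ) - 2)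

def beta2 (μ₂ δ γ ζ : ℝ) : ℝ := γ * (δ * (1 + ζ) * μ₂ - 1)

def beta3 (γ ζ : ℝ) : ℝ := ζ * γ ^ 2 + γ ^ 2 + γ

open Classical in
/-- The constant `α`, in the two regimes `δ μ₂ (1 + ζ) ≤ 1` and `δ μ₂ (1 + ζ) > 1`. -/
def alphaC (μ₁ μ₂ δ γ ζ : ℝ) : ℝ :=
  if δ * μ₂ * (1 + ζ) ≤ 1 then
    max 0 (beta3 γ ζ / ζ - beta1 μ₁ δ γ ζ - beta2 μ₂ δ γ ζ)
  else
    max 0 (max (beta3 γ ζ / ζ - beta1 μ₁ δ γ ζ)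
      ((-beta1 μ₁ δ γ ζ + √(beta1 μ₁ δ γ ζ ^ 2 + 4 * beta2 μ₂ δ γ ζ)) / 2))

open Classical in
/-- The rate `ρ`, in the two regimes `δ μ₂ (1 + ζ) ≤ 1` and `δ μ₂ (1 + ζ) > 1`. -/
def rhoC (μ₁ μ₂ δ γ ζ : ℝ) : ℝ :=
  if δ * μ₂ * (1 + ζ) ≤ 1 then
    max (beta1 μ₁ δ γ ζ + beta2 μ₂ δ γ ζ) (beta3 γ ζ / ζ)
  else
    max (beta3 γ ζ / ζ)
      ((beta1 μ₁ δ γ ζ + √(beta1 μ₁ δ γ ζ ^ 2 + 4 * beta2 μ₂ δ γ ζ)) / 2)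

/-- The lower bound that `k - 1` has to exceed. -/
def threshold (n : ℕ) (σ ξ ψ α ρbar : ℝ) : ℝ :=
  (4 * σ - 4 - Real.logb 2 n + Real.logb 2 (1 + α) + Real.logb 2 ξ + 2 * Real.logb 2 ψ) /
    Real.logb 2 (1 / ρbar)

/-- The bound `H(σ, ξ, ψ, α, k, ρbar)`. -/
def boundH (n : ℕ) (σ ξ ψ α ρbar : ℝ) (k : ℕ) : ℝ :=
  √(ξ * (1 + α) / n) * ψ * (2 : ℝ) ^ (2 * σ - 2) * ρbar ^ (((k : ℝ) - 1) / 2)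

end ASPM

end

noncomputable section

namespace ASPM

/-! ### The `B`-inner product -/

section BInner

variable {n : ℕ} {B : Matrix (Fin n) (Fin n) ℝ}

/-! By Markov's inequality the failure probability is at most `E θ(x_k) / 2^(1-σ)`, and three
estimates bound this expectation. The violation is Lipschitz: θ ≤ ψ d_B / √λ_min
(`maxViolation_le`). The initial distance d_B(0, X) is at most √λ_max 2^(σ-1) / √n
(`bDist_zero_le`), since Cramer's rule bounds some feasible point by the size of the data
(`exists_feasible_abs_le`). Finally E d_B(x_k, X) ≤ √((1+α) ρbar^(k-1)) d_B(0, X).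

The contraction has two sources. On `setQ`, expected distance and expected step length obey a linear
2×2 comparison system with larger eigenvalue `rho2`, and a left eigenvector merges them into one
Lyapunov function (`expStep_pow_bDist_le`). On `setR ∩ setS`, convexity of f gives a recursion for
squared distance plus ζ times squared step length, in which the previous distance also enters
(`expStep_energy_le`); `expStep_pow_sq_bDist_le` solves it according to the sign of `beta2`, and
Jensen takes the root. Greedy rules qualify because their f is an average of maxima of convex
functions. In the third case the first source alone suffices.

Expectations are iterates of the transition operator `expStep`. Distances are estimated against an
arbitrary feasible y before passing to the infimum, so no projection onto X is needed. -/

lemma bInner_add_left (x y z : Fin n → ℝ) : bInner B (x + y) z = bInner B x z + bInner B y z := by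
  simp [bInner, add_dotProduct]

lemma bInner_add_right (x y z : Fin n → ℝ) : bInner B x (y + z) = bInner B x y + bInner B x z := by
  simp [bInner, Matrix.mulVec_add, dotProduct_add]

lemma bInner_sub_right (x y z : Fin n → ℝ) : bInner B x (y - z) = bInner B x y - bInner B x z := by
  simp [bInner, Matrix.mulVec_sub, dotProduct_sub]

lemma bInner_smul_left (c : ℝ) (x y : Fin n → ℝ) : bInner B (c • x) y = c * bInner B x y := by
  simp [bInner]

lemma bInner_smul_right (c : ℝ) (x y : Fin n → ℝ) : bInner B x (c • y) = c * bInner B x y := by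
  simp [bInner, Matrix.mulVec_smul]

lemma bInner_sum_left {ι : Type*} (s : Finset ι) (v : ι → Fin n → ℝ) (y : Fin n → ℝ) :
    bInner B (∑ i ∈ s, v i) y = ∑ i ∈ s, bInner B (v i) y := by
  simp [bInner, sum_dotProduct]

lemma bInner_comm (hB : B.PosDef) (x y : Fin n → ℝ) : bInner B x y = bInner B y x := by
  have h : Bᵀ = B := hB.1
  rw [bInner, bInner, Matrix.dotProduct_mulVec, ← Matrix.mulVec_transpose, h, dotProduct_comm]

lemma bInner_self_nonneg (hB : B.PosDef) (x : Fin n → ℝ) : 0 ≤ bInner B x x := by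
  simpa [bInner] using hB.posSemidef.dotProduct_mulVec_nonneg x

lemma bInner_self_pos (hB : B.PosDef) {x : Fin n → ℝ} (hx : x ≠ 0) : 0 < bInner B x x := by
  simpa [bInner] using hB.dotProduct_mulVec_pos hx

lemma bNorm_nonneg (x : Fin n → ℝ) : 0 ≤ bNorm B x := Real.sqrt_nonneg _

lemma bNorm_sq (hB : B.PosDef) (x : Fin n → ℝ) : bNorm B x ^ 2 = bInner B x x :=
  Real.sq_sqrt (bInner_self_nonneg hB x)

open scoped MatrixOrder Matrix.Norms.L2Operator in
-- Positivity factors B as CᵀC. The B-norm is then a pulled-back Euclidean norm and inherits the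
-- triangle inequality and homogeneity.
lemma exists_bNorm_eq_norm (hB : B.PosDef) :
    ∃ C : Matrix (Fin n) (Fin n) ℝ, ∀ x, bNorm B x = ‖WithLp.toLp 2 (C *ᵥ x)‖ := by
  obtain ⟨C, hC⟩ := CStarAlgebra.nonneg_iff_eq_star_mul_self.mp hB.posSemidef.nonneg
  refine ⟨C, fun x => ?_⟩
  rw [bNorm, EuclideanSpace.norm_eq, bInner, hC, ← Matrix.mulVec_mulVec, Matrix.dotProduct_mulVec,
    Matrix.star_eq_conjTranspose, Matrix.conjTranspose_eq_transpose_of_trivial, Matrix.vecMul_transpose]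
  simp [dotProduct, sq]

lemma bNorm_add_le (hB : B.PosDef) (x y : Fin n → ℝ) : bNorm B (x + y) ≤ bNorm B x + bNorm B y := by
  obtain ⟨C, hC⟩ := exists_bNorm_eq_norm hB
  simp only [hC, Matrix.mulVec_add, WithLp.toLp_add]
  exact norm_add_le _ _

lemma bNorm_smul (hB : B.PosDef) (c : ℝ) (x : Fin n → ℝ) : bNorm B (c • x) = |c| * bNorm B x := by
  obtain ⟨C, hC⟩ := exists_bNorm_eq_norm hB
  simp only [hC, Matrix.mulVec_smul, WithLp.toLp_smul, norm_smul, Real.norm_eq_abs]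

lemma bDist_nonneg (x : Fin n → ℝ) (X : Set (Fin n → ℝ)) : 0 ≤ bDist B x X :=
  Real.sInf_nonneg (by rintro _ ⟨y, -, rfl⟩; exact bNorm_nonneg _)

lemma bDist_le {X : Set (Fin n → ℝ)} (x : Fin n → ℝ) {y : Fin n → ℝ} (hy : y ∈ X) :
    bDist B x X ≤ bNorm B (y - x) :=
  csInf_le ⟨0, by rintro _ ⟨y, -, rfl⟩; exact bNorm_nonneg _⟩ ⟨y, hy, rfl⟩

/-- A bound by a continuous function of the distance to every point of `X` passes to the infimum. -/
lemma le_of_forall_bNorm {X : Set (Fin n → ℝ)} (hX : X.Nonempty) (x : Fin n → ℝ) {F : ℝ → ℝ}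
    (hF : Continuous F) {a : ℝ} (h : ∀ y ∈ X, a ≤ F (bNorm B (y - x))) : a ≤ F (bDist B x X) := by
  obtain ⟨u, -, hu, hmem⟩ := exists_seq_tendsto_sInf (S := (fun y => bNorm B (y - x)) '' X)
    (hX.image _) ⟨0, by rintro _ ⟨y, -, rfl⟩; exact bNorm_nonneg _⟩
  refine ge_of_tendsto' ((hF.tendsto _).comp hu) fun k => ?_
  obtain ⟨y, hy, hyk⟩ := hmem k
  simpa [← hyk] using h y hy

end BInner

/-! ### Extreme eigenvalues -/

section Spectrum

variable {n : ℕ} {B : Matrix (Fin n) (Fin n) ℝ}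

lemma spectrum_nonempty [NeZero n] (hB : B.PosDef) : (spectrum ℝ B).Nonempty := by
  rw [hB.1.spectrum_real_eq_range_eigenvalues]
  exact Set.range_nonempty _

lemma spectrum_finite (hB : B.PosDef) : (spectrum ℝ B).Finite := by
  rw [hB.1.spectrum_real_eq_range_eigenvalues]
  exact Set.finite_range _

lemma sInf_spectrum_pos [NeZero n] (hB : B.PosDef) : 0 < sInf (spectrum ℝ B) := by
  have h := (spectrum_nonempty hB).csInf_mem (spectrum_finite hB)
  rw [hB.1.spectrum_real_eq_range_eigenvalues] at h
  obtain ⟨i, hi⟩ := h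
  rw [hB.1.spectrum_real_eq_range_eigenvalues, ← hi]
  exact hB.eigenvalues_pos i

lemma sInf_spectrum_le_sSup [NeZero n] (hB : B.PosDef) :
    sInf (spectrum ℝ B) ≤ sSup (spectrum ℝ B) :=
  csInf_le_csSup (spectrum_nonempty hB) (spectrum_finite hB).bddBelow (spectrum_finite hB).bddAbove

lemma condNumber_pos [NeZero n] (hB : B.PosDef) : 0 < condNumber B :=
  div_pos ((sInf_spectrum_pos hB).trans_le (sInf_spectrum_le_sSup hB)) (sInf_spectrum_pos hB)

/-- Subtracting a scalar matrix shifts the spectrum, so B - λ_min I has nonnegative spectrum and is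
positive semidefinite. -/
lemma sInf_spectrum_mul_le (hB : B.PosDef) (x : Fin n → ℝ) :
    sInf (spectrum ℝ B) * (x ⬝ᵥ x) ≤ bInner B x x := by
  have h : (B - algebraMap ℝ _ (sInf (spectrum ℝ B))).PosSemidef := by
    rw [Matrix.posSemidef_iff_isHermitian_and_spectrum_nonneg]
    refine ⟨hB.1.sub ?_, ?_⟩
    · simp [Matrix.IsHermitian, Matrix.algebraMap_eq_diagonal]
    · rw [← spectrum.sub_singleton_eq]
      rintro _ ⟨a, ha, _, rfl, rfl⟩
      simpa using csInf_le (spectrum_finite hB).bddBelow ha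
  have := h.dotProduct_mulVec_nonneg x
  simp only [star_trivial, Matrix.sub_mulVec, dotProduct_sub, Algebra.algebraMap_eq_smul_one,
    Matrix.smul_mulVec, Matrix.one_mulVec, dotProduct_smul, smul_eq_mul] at this
  simpa [bInner] using this

lemma le_sSup_spectrum_mul (hB : B.PosDef) (x : Fin n → ℝ) :
    bInner B x x ≤ sSup (spectrum ℝ B) * (x ⬝ᵥ x) := by
  have h : (algebraMap ℝ _ (sSup (spectrum ℝ B)) - B).PosSemidef := by
    rw [Matrix.posSemidef_iff_isHermitian_and_spectrum_nonneg]
    refine ⟨Matrix.IsHermitian.sub ?_ hB.1, ?_⟩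
    · simp [Matrix.IsHermitian, Matrix.algebraMap_eq_diagonal]
    · rw [← spectrum.singleton_sub_eq]
      rintro _ ⟨_, rfl, a, ha, rfl⟩
      simpa using le_csSup (spectrum_finite hB).bddAbove ha
  have := h.dotProduct_mulVec_nonneg x
  simp only [star_trivial, Matrix.sub_mulVec, dotProduct_sub, Algebra.algebraMap_eq_smul_one,
    Matrix.smul_mulVec, Matrix.one_mulVec, dotProduct_smul, smul_eq_mul] at this
  simpa [bInner] using this

end Spectrum

/-! ### Sketched losses -/

section SketchFacts

variable {m n q : ℕ} {A : Matrix (Fin m) (Fin n) ℝ} {b : Fin m → ℝ}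
  {B : Matrix (Fin n) (Fin n) ℝ} {S : Fin q → Fin m → ℝ}

lemma bInner_inv_mulVec (hB : B.PosDef) (v w : Fin n → ℝ) : bInner B (B⁻¹ *ᵥ v) w = v ⬝ᵥ w := by
  rw [bInner_comm hB, bInner, Matrix.mulVec_mulVec,
    Matrix.mul_nonsing_inv _ ((Matrix.isUnit_iff_isUnit_det B).1 hB.isUnit), Matrix.one_mulVec,
    dotProduct_comm]

lemma sketchScale_pos (hB : B.PosDef) (hAS : ∀ i, Aᵀ *ᵥ S i ≠ 0) (i : Fin q) :
    0 < sketchScale A B S i :=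
  bInner_self_pos hB.inv (hAS i)

lemma bInner_sketchGrad (hB : B.PosDef) (i : Fin q) (x w : Fin n → ℝ) :
    bInner B (sketchGrad A b B S i x) w =
      sketchResidual A b S i x / sketchScale A B S i * (S i ⬝ᵥ (A *ᵥ w)) := by
  rw [sketchGrad, bInner_smul_left, bInner_inv_mulVec hB, Matrix.dotProduct_mulVec,
    Matrix.mulVec_transpose]

/-- This is what the normalisation of f_i achieves: the quadratic term of a gradient step is again a
multiple of the loss. -/
lemma bInner_sketchGrad_self (hB : B.PosDef) (hAS : ∀ i, Aᵀ *ᵥ S i ≠ 0) (i : Fin q)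
    (x : Fin n → ℝ) :
    bInner B (sketchGrad A b B S i x) (sketchGrad A b B S i x) = 2 * sketchLoss A b B S i x := by
  have hs := (sketchScale_pos hB hAS i).ne'
  have h : S i ⬝ᵥ (A *ᵥ (B⁻¹ *ᵥ (Aᵀ *ᵥ S i))) = sketchScale A B S i := by
    rw [Matrix.dotProduct_mulVec, ← Matrix.mulVec_transpose]; rfl
  rw [bInner_sketchGrad hB, sketchGrad, Matrix.mulVec_smul, dotProduct_smul, h, sketchLoss,
    smul_eq_mul]
  field_simp

/-- Along the scalar S_iᵀ(Ax - b) this is the tangent inequality for the convex function t ↦ (t⁺)².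
-/
lemma sketchLoss_add_bInner_le (hB : B.PosDef) (hAS : ∀ i, Aᵀ *ᵥ S i ≠ 0) (i : Fin q)
    (x y : Fin n → ℝ) :
    sketchLoss A b B S i x + bInner B (sketchGrad A b B S i x) (y - x) ≤ sketchLoss A b B S i y := by
  have hs := sketchScale_pos hB hAS i
  have h : S i ⬝ᵥ (A *ᵥ (y - x)) = S i ⬝ᵥ (A *ᵥ y - b) - S i ⬝ᵥ (A *ᵥ x - b) := by
    rw [← dotProduct_sub, Matrix.mulVec_sub]; congr 1; abel
  rw [bInner_sketchGrad hB, h]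
  simp only [sketchLoss, sketchResidual]
  generalize S i ⬝ᵥ (A *ᵥ y - b) = v
  generalize S i ⬝ᵥ (A *ᵥ x - b) = u
  generalize sketchScale A B S i = c at *
  have key : max u 0 ^ 2 + 2 * max u 0 * (v - u) ≤ max v 0 ^ 2 := by
    rcases max_cases u 0 with ⟨h1, h2⟩ | ⟨h1, h2⟩ <;> rcases max_cases v 0 with ⟨h3, h4⟩ | ⟨h3, h4⟩ <;>
      rw [h1, h3] <;> nlinarith [sq_nonneg (u - v)]
  have e : max u 0 ^ 2 / (2 * c) + max u 0 / c * (v - u) =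
      (max u 0 ^ 2 + 2 * max u 0 * (v - u)) / (2 * c) := by field_simp
  rw [e]
  gcongr

/-- Since S_i ≥ 0, a feasible y has nonpositive sketched residual, so moving from x to y removes at
least the whole residual u⁺. This gains a factor 2 over plain convexity. -/
lemma two_mul_sketchLoss_le (hB : B.PosDef) (hS : ∀ i j, 0 ≤ S i j) (hAS : ∀ i, Aᵀ *ᵥ S i ≠ 0)
    (i : Fin q) (x : Fin n → ℝ) {y : Fin n → ℝ} (hy : y ∈ feasible A b) :
    2 * sketchLoss A b B S i x ≤ -bInner B (sketchGrad A b B S i x) (y - x) := by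
  have hs := sketchScale_pos hB hAS i
  have h : S i ⬝ᵥ (A *ᵥ (y - x)) = S i ⬝ᵥ (A *ᵥ y - b) - S i ⬝ᵥ (A *ᵥ x - b) := by
    rw [← dotProduct_sub, Matrix.mulVec_sub]; congr 1; abel
  have hv : S i ⬝ᵥ (A *ᵥ y - b) ≤ 0 := by
    refine Finset.sum_nonpos fun j _ => mul_nonpos_of_nonneg_of_nonpos (hS i j) ?_
    simpa using hy j
  rw [bInner_sketchGrad hB, h]
  simp only [sketchLoss, sketchResidual]
  generalize S i ⬝ᵥ (A *ᵥ y - b) = v at *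
  generalize S i ⬝ᵥ (A *ᵥ x - b) = u
  generalize sketchScale A B S i = c at *
  have key : max u 0 ^ 2 ≤ max u 0 * (u - v) := by
    rcases max_cases u 0 with ⟨h1, h2⟩ | ⟨h1, h2⟩ <;> rw [h1] <;> nlinarith
  have e : -(max u 0 / c * (v - u)) = max u 0 * (u - v) / c := by field_simp; ring
  have e2 : 2 * (max u 0 ^ 2 / (2 * c)) = max u 0 ^ 2 / c := by field_simp
  rw [e, e2]
  gcongr

lemma sum_toReal_eq_one {ι : Type*} [Fintype ι] (p : PMF ι) : ∑ i, (p i).toReal = 1 := by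
  rw [← ENNReal.toReal_sum fun i _ => p.apply_ne_top i, ← tsum_fintype (L := .unconditional _), p.tsum_coe,
    ENNReal.toReal_one]

/-- Greedy rules are convex: a maximiser at `x` may be suboptimal at `y`. -/
lemma IsGreedyRule.isConvexRule (hB : B.PosDef) (hAS : ∀ i, Aᵀ *ᵥ S i ≠ 0) {R : SamplingRule n q}
    (hR : IsGreedyRule A b B S R) : IsConvexRule A b B S R := by
  obtain ⟨ν, c, -, hc, hR⟩ := hR
  have hw : ∀ (x : Fin n → ℝ) (V : Fin q → ℝ), ∑ i, (R x i).toReal * V i =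
      ∑ φ, (ν φ).toReal * ∑ i, (c x φ i).toReal * V i := by
    intro x V
    simp only [hR, PMF.bind_apply, tsum_fintype, Finset.mul_sum]
    rw [Finset.sum_comm]
    refine Finset.sum_congr rfl fun i _ => ?_
    rw [ENNReal.toReal_sum fun φ _ => ENNReal.mul_ne_top (ν.apply_ne_top φ) ((c x φ).apply_ne_top i),
      Finset.sum_mul]
    simp [ENNReal.toReal_mul, mul_assoc]
  intro x y
  -- Averaging the tangent inequalities leaves the losses at y weighted by the law at x. It remains
  -- to replace that law by the one at y.
  have h1 : expLoss A b B S R x + bInner B (expGrad A b B S R x) (y - x) ≤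
      ∑ i, (R x i).toReal * sketchLoss A b B S i y := by
    simp only [expLoss, expGrad, bInner_sum_left, bInner_smul_left, ← Finset.sum_add_distrib,
      ← mul_add]
    gcongr
    exact sketchLoss_add_bInner_le hB hAS _ _ _
  refine h1.trans ?_
  rw [expLoss, hw, hw]
  refine Finset.sum_le_sum fun φ _ => ?_
  by_cases hφ : φ ∈ ν.support
  swap
  · rw [PMF.mem_support_iff, not_not] at hφ
    simp [hφ]
  gcongr ?_ * ?_
  -- For a common set φ, the choices i at x and j at y are coupled independently. Both lie in φ, so
  -- j, maximal at y, beats i there.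
  have hsplit : ∀ V : Fin q → ℝ, ∑ i, (c x φ i).toReal * V i =
      ∑ i, ∑ j, (c x φ i).toReal * (c y φ j).toReal * V i := by
    intro V
    refine Finset.sum_congr rfl fun i _ => ?_
    rw [← Finset.sum_mul, ← Finset.mul_sum, sum_toReal_eq_one, mul_one]
  rw [hsplit]
  calc ∑ i, ∑ j, (c x φ i).toReal * (c y φ j).toReal * sketchLoss A b B S i y
      ≤ ∑ i, ∑ j, (c x φ i).toReal * (c y φ j).toReal * sketchLoss A b B S j y := by
        refine Finset.sum_le_sum fun i _ => Finset.sum_le_sum fun j _ => ?_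
        by_cases hi : i ∈ (c x φ).support
        swap
        · rw [PMF.mem_support_iff, not_not] at hi
          simp [hi]
        by_cases hj : j ∈ (c y φ).support
        swap
        · rw [PMF.mem_support_iff, not_not] at hj
          simp [hj]
        gcongr
        exact (hc y φ hφ j hj).2 i (hc x φ hφ i hi).1
    _ = ∑ j, (c y φ j).toReal * sketchLoss A b B S j y := by
        rw [Finset.sum_comm]
        refine Finset.sum_congr rfl fun j _ => ?_
        simp_rw [mul_assoc, ← Finset.sum_mul, sum_toReal_eq_one, one_mul]

end SketchFacts

/-! ### The transition operator of the algorithm -/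

section Operator

variable {m n q : ℕ} (A : Matrix (Fin m) (Fin n) ℝ) (b : Fin m → ℝ)
  (B : Matrix (Fin n) (Fin n) ℝ) (S : Fin q → Fin m → ℝ) (R : SamplingRule n q) (δ γ : ℝ)

/-- The conditional expectation of `V` at the next pair of iterates, given the current pair. -/
def expStep : Module.End ℝ ((Fin n → ℝ) × (Fin n → ℝ) → ℝ) where
  toFun V s := ∑ i, (R s.2 i).toReal * V (step A b B S δ γ i s)
  map_add' V W := by ext s; simp [mul_add, Finset.sum_add_distrib]
  map_smul' c V := by ext s; simp [Finset.mul_sum, mul_left_comm]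

variable {A b B S R δ γ}

lemma expStep_apply (V : (Fin n → ℝ) × (Fin n → ℝ) → ℝ) (s : (Fin n → ℝ) × (Fin n → ℝ)) :
    expStep A b B S R δ γ V s = ∑ i, (R s.2 i).toReal * V (step A b B S δ γ i s) := rfl

lemma expStep_mono {V W : (Fin n → ℝ) × (Fin n → ℝ) → ℝ} (h : V ≤ W) :
    expStep A b B S R δ γ V ≤ expStep A b B S R δ γ W := by
  intro s
  simp only [expStep_apply]
  gcongr
  exact h _

lemma expStep_pow_mono {V W : (Fin n → ℝ) × (Fin n → ℝ) → ℝ} (h : V ≤ W) (k : ℕ) :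
    (expStep A b B S R δ γ ^ k) V ≤ (expStep A b B S R δ γ ^ k) W := by
  induction k generalizing V W with
  | zero => simpa using h
  | succ k ih => simpa [pow_succ] using ih (expStep_mono h)

/-- A step shifts the pair: its new first entry is the old second one, whichever index is drawn. -/
lemma expStep_fst (g : (Fin n → ℝ) → ℝ) :
    expStep A b B S R δ γ (fun s => g s.1) = fun s => g s.2 := by
  ext s
  simp [expStep_apply, step, ← Finset.sum_mul, sum_toReal_eq_one]

lemma expStep_pow_const (c : ℝ) (k : ℕ) :
    (expStep A b B S R δ γ ^ k) (fun _ => c) = fun _ => c := by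
  induction k with
  | zero => simp
  | succ k ih => rw [pow_succ, Module.End.mul_apply, expStep_fst (fun _ => c), ih]

/-- Peels off the last step of the algorithm, so that a one-step inequality can be averaged over the
earlier steps. -/
lemma expStep_pow_succ_apply (k : ℕ) (V : (Fin n → ℝ) × (Fin n → ℝ) → ℝ) :
    (expStep A b B S R δ γ ^ (k + 1)) V =
      (expStep A b B S R δ γ ^ k) (expStep A b B S R δ γ V) := by
  rw [pow_succ, Module.End.mul_apply]

lemma expStep_pow_nonneg {V : (Fin n → ℝ) × (Fin n → ℝ) → ℝ} (h : 0 ≤ V) (k : ℕ) :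
    0 ≤ (expStep A b B S R δ γ ^ k) V := by
  simpa using expStep_pow_mono (A := A) (b := b) (B := B) (S := S) (R := R) (δ := δ) (γ := γ) h k

/-- Jensen's inequality for the square. -/
lemma sq_expStep_pow_le (V : (Fin n → ℝ) × (Fin n → ℝ) → ℝ) (k : ℕ)
    (s : (Fin n → ℝ) × (Fin n → ℝ)) :
    (expStep A b B S R δ γ ^ k) V s ^ 2 ≤ (expStep A b B S R δ γ ^ k) (fun s => V s ^ 2) s := by
  set c := (expStep A b B S R δ γ ^ k) V s with hc
  -- Nonnegativity of the variance about the mean c.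
  have h := expStep_pow_nonneg (A := A) (b := b) (B := B) (S := S) (R := R) (δ := δ) (γ := γ)
    (V := (fun s => V s ^ 2) - (2 * c) • V + fun _ => c ^ 2)
    (fun s => by simpa using by nlinarith [sq_nonneg (V s - c)]) k s
  rw [map_add, map_sub, map_smul, expStep_pow_const] at h
  simp only [Pi.zero_apply, Pi.add_apply, Pi.sub_apply, Pi.smul_apply, smul_eq_mul, ← hc] at h
  nlinarith

lemma pow_mul_of_expStep_le {V : (Fin n → ℝ) × (Fin n → ℝ) → ℝ} {ρ : ℝ} (hρ : 0 ≤ ρ)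
    (h : expStep A b B S R δ γ V ≤ ρ • V) (k : ℕ) :
    (expStep A b B S R δ γ ^ k) V ≤ ρ ^ k • V := by
  induction k with
  | zero => simp
  | succ k ih =>
    rw [expStep_pow_succ_apply, pow_succ', mul_smul]
    refine (expStep_pow_mono h k).trans ?_
    rw [map_smul]
    exact smul_le_smul_of_nonneg_left ih hρ

/-- Integrating against the law of the pair of iterates is applying the transition operator. -/
lemma tsum_pairLaw_mul (x₀ : Fin n → ℝ) (k : ℕ) {V : (Fin n → ℝ) × (Fin n → ℝ) → ℝ} (hV : 0 ≤ V) :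
    ∑' s, pairLaw A b B S R δ γ x₀ k s * ENNReal.ofReal (V s) =
      ENNReal.ofReal ((expStep A b B S R δ γ ^ k) V (x₀, x₀)) := by
  induction k generalizing V with
  | zero =>
    rw [tsum_eq_single (x₀, x₀) fun s hs => by simp [pairLaw, PMF.pure_apply, hs]]
    simp [pairLaw]
  | succ k ih =>
    have h0 : 0 ≤ expStep A b B S R δ γ V := by
      simpa using expStep_mono (A := A) (b := b) (B := B) (S := S) (R := R) (δ := δ) (γ := γ) hV
    rw [expStep_pow_succ_apply, ← ih h0]
    simp only [pairLaw, PMF.bind_apply, ← ENNReal.tsum_mul_right]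
    rw [ENNReal.tsum_comm]
    refine tsum_congr fun s => ?_
    simp only [mul_assoc, ENNReal.tsum_mul_left]
    congr 1
    rw [expStep_apply, ENNReal.ofReal_sum_of_nonneg
      fun i _ => mul_nonneg ENNReal.toReal_nonneg (hV _)]
    classical
    simp only [PMF.map_apply, tsum_fintype, Finset.sum_mul]
    rw [Summable.tsum_finsetSum fun i _ => ENNReal.summable]
    refine Finset.sum_congr rfl fun i _ => ?_
    rw [tsum_eq_single (step A b B S δ γ i s) fun t ht => by simp [ht]]
    rw [if_pos rfl, ENNReal.ofReal_mul ENNReal.toReal_nonneg,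
      ENNReal.ofReal_toReal ((R s.2).apply_ne_top i)]

/-- Markov's inequality for the law of an iterate. -/
lemma iterateLaw_toReal_le (x₀ : Fin n → ℝ) (k : ℕ) {U : Set (Fin n → ℝ)} {g : (Fin n → ℝ) → ℝ}
    (hg : 0 ≤ g) (hU : ∀ x ∈ U, 1 ≤ g x) :
    ((iterateLaw A b B S R δ γ x₀ k).toOuterMeasure U).toReal ≤
      (expStep A b B S R δ γ ^ k) (fun s => g s.1) (x₀, x₀) := by
  have hg' : (0 : (Fin n → ℝ) × (Fin n → ℝ) → ℝ) ≤ fun s => g s.1 := fun s => hg s.1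
  refine ENNReal.toReal_le_of_le_ofReal (expStep_pow_nonneg hg' k _) ?_
  rw [← tsum_pairLaw_mul x₀ k hg', iterateLaw, PMF.toOuterMeasure_map_apply,
    PMF.toOuterMeasure_apply]
  refine ENNReal.tsum_le_tsum fun s => ?_
  by_cases hs : s ∈ Prod.fst ⁻¹' U
  · rw [Set.indicator_of_mem hs]
    exact le_mul_of_one_le_right' (ENNReal.one_le_ofReal.2 (hU _ hs))
  · simp [Set.indicator_of_notMem hs]

end Operator

/-! ### One step of the algorithm, in expectation -/

lemma sum_mul_le_sqrt {ι : Type*} [Fintype ι] (p : PMF ι) (a : ι → ℝ) :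
    ∑ i, (p i).toReal * a i ≤ √(∑ i, (p i).toReal * a i ^ 2) := by
  apply Real.le_sqrt_of_sq_le
  set c := ∑ i, (p i).toReal * a i with hc
  have h : 0 ≤ ∑ i, (p i).toReal * (a i - c) ^ 2 :=
    Finset.sum_nonneg fun i _ => mul_nonneg ENNReal.toReal_nonneg (sq_nonneg _)
  have e : ∑ i, (p i).toReal * (a i - c) ^ 2 =
      ∑ i, (p i).toReal * a i ^ 2 - 2 * c * ∑ i, (p i).toReal * a i +
        c ^ 2 * ∑ i, (p i).toReal := by
    simp only [Finset.mul_sum, ← Finset.sum_sub_distrib, ← Finset.sum_add_distrib]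
    exact Finset.sum_congr rfl fun i _ => by ring
  rw [e, ← hc, sum_toReal_eq_one] at h
  nlinarith

section OneStep

variable {m n q : ℕ} {A : Matrix (Fin m) (Fin n) ℝ} {b : Fin m → ℝ}
  {B : Matrix (Fin n) (Fin n) ℝ} {S : Fin q → Fin m → ℝ} {R : SamplingRule n q} {δ γ : ℝ}

lemma sum_mul_affine_loss (x : Fin n → ℝ) (c e : ℝ) :
    ∑ i, (R x i).toReal * (c + e * sketchLoss A b B S i x) = c + e * expLoss A b B S R x := by
  simp only [mul_add, Finset.sum_add_distrib, ← Finset.sum_mul, sum_toReal_eq_one, one_mul, expLoss,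
    Finset.mul_sum, mul_left_comm]

/-- The triangle inequality splits off the momentum. For feasible y the rest satisfies ‖y - x +
δ∇f_i‖² ≤ ‖y - x‖² - 2(2δ - δ²) f_i(x), whose mean is controlled by the lower bound on f. -/
lemma expStep_bDist_le (hB : B.PosDef) (hS : ∀ i j, 0 ≤ S i j) (hAS : ∀ i, Aᵀ *ᵥ S i ≠ 0)
    (hX : (feasible A b).Nonempty) {μ₁ : ℝ}
    (hμ : ∀ x, μ₁ / 2 * bDist B x (feasible A b) ^ 2 ≤ expLoss A b B S R x)
    (hδ : 0 < δ) (hδ2 : δ < 2) (hγ : 0 ≤ γ) (s : (Fin n → ℝ) × (Fin n → ℝ)) :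
    expStep A b B S R δ γ (fun s => bDist B s.2 (feasible A b)) s ≤
      √(hR μ₁ δ) * bDist B s.2 (feasible A b) + γ * bNorm B (s.2 - s.1) := by
  obtain ⟨z, x⟩ := s
  set d := bDist B x (feasible A b) with hd
  have key : ∀ y ∈ feasible A b, expStep A b B S R δ γ (fun s => bDist B s.2 (feasible A b)) (z, x) ≤
      √(bNorm B (y - x) ^ 2 - (2 * δ - δ ^ 2) * μ₁ * d ^ 2) + γ * bNorm B (x - z) := by
    intro y hy
    have hi : ∀ i, bDist B (step A b B S δ γ i (z, x)).2 (feasible A b) ≤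
        bNorm B (y - x + δ • sketchGrad A b B S i x) + γ * bNorm B (x - z) := by
      intro i
      refine (bDist_le _ hy).trans ?_
      have e : y - (step A b B S δ γ i (z, x)).2 =
          (y - x + δ • sketchGrad A b B S i x) + (-γ) • (x - z) := by
        simp only [step, neg_smul]; abel
      rw [e]
      refine (bNorm_add_le hB _ _).trans_eq ?_
      rw [bNorm_smul hB, abs_neg, abs_of_nonneg hγ]
    have hsq : ∀ i, bNorm B (y - x + δ • sketchGrad A b B S i x) ^ 2 ≤
        bNorm B (y - x) ^ 2 + -(2 * (2 * δ - δ ^ 2)) * sketchLoss A b B S i x := by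
      intro i
      have h1 := bInner_sketchGrad_self (b := b) hB hAS i x
      have h2 := two_mul_sketchLoss_le hB hS hAS i x hy
      rw [bNorm_sq hB, bNorm_sq hB]
      simp only [bInner_add_left, bInner_add_right, bInner_smul_left, bInner_smul_right, h1,
        bInner_comm hB (y - x) (sketchGrad A b B S i x)]
      nlinarith
    calc expStep A b B S R δ γ (fun s => bDist B s.2 (feasible A b)) (z, x)
        ≤ ∑ i, (R x i).toReal * (bNorm B (y - x + δ • sketchGrad A b B S i x) +
            γ * bNorm B (x - z)) := by
          rw [expStep_apply]; gcongr; exact hi _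
      _ = ∑ i, (R x i).toReal * bNorm B (y - x + δ • sketchGrad A b B S i x) +
            γ * bNorm B (x - z) := by
          simp only [mul_add, Finset.sum_add_distrib, ← Finset.sum_mul, sum_toReal_eq_one, one_mul]
      _ ≤ _ := by
          gcongr
          refine (sum_mul_le_sqrt _ _).trans (Real.sqrt_le_sqrt ?_)
          calc _ ≤ ∑ i, (R x i).toReal * (bNorm B (y - x) ^ 2 +
                -(2 * (2 * δ - δ ^ 2)) * sketchLoss A b B S i x) := by gcongr; exact hsq _
            _ ≤ _ := by
                rw [sum_mul_affine_loss]
                have : 0 < 2 * δ - δ ^ 2 := by nlinarith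
                nlinarith [hμ x]
  -- The distance d from the lower bound on f stays fixed; only ‖y - x‖ tends to its infimum.
  have := le_of_forall_bNorm (B := B) hX x
    (F := fun t => √(t ^ 2 - (2 * δ - δ ^ 2) * μ₁ * d ^ 2) + γ * bNorm B (x - z))
    (by fun_prop) key
  refine this.trans_eq ?_
  have e : d ^ 2 - (2 * δ - δ ^ 2) * μ₁ * d ^ 2 = hR μ₁ δ * d ^ 2 := by rw [hR]; ring
  simp only [← hd, e]
  rw [Real.sqrt_mul' _ (sq_nonneg d), Real.sqrt_sq (bDist_nonneg _ _)]

/-- The new step is -δ∇f_i plus γ times the old one, and E‖∇f_i‖ ≤ √(2f) ≤ √μ₂ d. With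
`expStep_bDist_le` it forms the comparison system with rows (√h, γ) and (δ√μ₂, γ). -/
lemma expStep_bNorm_le (hB : B.PosDef) (hAS : ∀ i, Aᵀ *ᵥ S i ≠ 0) {μ₂ : ℝ}
    (hμ : ∀ x, expLoss A b B S R x ≤ μ₂ / 2 * bDist B x (feasible A b) ^ 2)
    (hδ : 0 < δ) (hγ : 0 ≤ γ) (s : (Fin n → ℝ) × (Fin n → ℝ)) :
    expStep A b B S R δ γ (fun s => bNorm B (s.2 - s.1)) s ≤
      δ * √μ₂ * bDist B s.2 (feasible A b) + γ * bNorm B (s.2 - s.1) := by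
  obtain ⟨z, x⟩ := s
  have hi : ∀ i, bNorm B ((step A b B S δ γ i (z, x)).2 - (step A b B S δ γ i (z, x)).1) ≤
      δ * bNorm B (sketchGrad A b B S i x) + γ * bNorm B (x - z) := by
    intro i
    have e : (step A b B S δ γ i (z, x)).2 - (step A b B S δ γ i (z, x)).1 =
        (-δ) • sketchGrad A b B S i x + γ • (x - z) := by
      simp only [step, neg_smul]; abel
    rw [e]
    refine (bNorm_add_le hB _ _).trans_eq ?_
    rw [bNorm_smul hB, bNorm_smul hB, abs_neg, abs_of_pos hδ, abs_of_nonneg hγ]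
  calc expStep A b B S R δ γ (fun s => bNorm B (s.2 - s.1)) (z, x)
      ≤ ∑ i, (R x i).toReal * (δ * bNorm B (sketchGrad A b B S i x) + γ * bNorm B (x - z)) := by
        rw [expStep_apply]; gcongr; exact hi _
    _ = δ * ∑ i, (R x i).toReal * bNorm B (sketchGrad A b B S i x) + γ * bNorm B (x - z) := by
        simp only [mul_add, Finset.sum_add_distrib, ← Finset.sum_mul, sum_toReal_eq_one, one_mul]
        simp only [Finset.mul_sum, mul_left_comm]
    _ ≤ _ := by
        rw [mul_assoc]
        gcongr
        refine (sum_mul_le_sqrt _ _).trans ?_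
        rw [← Real.sqrt_sq (bDist_nonneg x (feasible A b)), ← Real.sqrt_mul' _ (sq_nonneg _)]
        apply Real.sqrt_le_sqrt
        simp only [bNorm_sq hB, bInner_sketchGrad_self hB hAS]
        have := sum_mul_affine_loss (A := A) (b := b) (B := B) (S := S) (R := R) x 0 2
        simp only [zero_add] at this
        rw [this]
        linarith [hμ x]

lemma expStep_energy_le (hB : B.PosDef) (hS : ∀ i j, 0 ≤ S i j) (hAS : ∀ i, Aᵀ *ᵥ S i ≠ 0)
    (hX : (feasible A b).Nonempty) (hconv : IsConvexRule A b B S R) {μ₁ μ₂ ζ : ℝ}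
    (hμ₁ : ∀ x, μ₁ / 2 * bDist B x (feasible A b) ^ 2 ≤ expLoss A b B S R x)
    (hμ₂ : ∀ x, expLoss A b B S R x ≤ μ₂ / 2 * bDist B x (feasible A b) ^ 2)
    (hδ : 0 < δ) (hγ : 0 ≤ γ) (hζ : 0 ≤ ζ) (hcoef : (1 + ζ) * (δ - γ) ≤ 2)
    (s : (Fin n → ℝ) × (Fin n → ℝ)) :
    expStep A b B S R δ γ
        (fun s => bDist B s.2 (feasible A b) ^ 2 + ζ * bNorm B (s.2 - s.1) ^ 2) s ≤
      beta1 μ₁ δ γ ζ * bDist B s.2 (feasible A b) ^ 2 +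
        beta2 μ₂ δ γ ζ * bDist B s.1 (feasible A b) ^ 2 +
        beta3 γ ζ * bNorm B (s.2 - s.1) ^ 2 := by
  obtain ⟨z, x⟩ := s
  set d := bDist B x (feasible A b) with hd
  set d' := bDist B z (feasible A b) with hd'
  have key : ∀ y ∈ feasible A b, expStep A b B S R δ γ
      (fun s => bDist B s.2 (feasible A b) ^ 2 + ζ * bNorm B (s.2 - s.1) ^ 2) (z, x) ≤
      (1 + γ) * bNorm B (y - x) ^ 2 + (δ * μ₁ * ((1 + ζ) * (δ - γ) - 2) * d ^ 2 +
        beta2 μ₂ δ γ ζ * d' ^ 2 + beta3 γ ζ * bNorm B (x - z) ^ 2) := by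
    intro y hy
    -- Testing the previous distance with the same y trades the indefinite term -2γ⟨y - x, x - z⟩
    -- for -γd'² plus squares. This produces the -γ in `beta2`.
    have hz : d' ^ 2 ≤ bNorm B (y - x) ^ 2 + 2 * bInner B (y - x) (x - z) + bNorm B (x - z) ^ 2 := by
      have h1 : d' ^ 2 ≤ bNorm B (y - z) ^ 2 :=
        pow_le_pow_left₀ (bDist_nonneg _ _) (bDist_le z hy) 2
      have e : y - z = (y - x) + (x - z) := by abel
      rw [bNorm_sq hB, e] at h1
      simp only [bNorm_sq hB]
      simp only [bInner_add_left (y - x), bInner_add_right _ (y - x),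
        bInner_comm hB (x - z) (y - x)] at h1
      linarith
    have hi : ∀ i, bDist B (step A b B S δ γ i (z, x)).2 (feasible A b) ^ 2 +
        ζ * bNorm B ((step A b B S δ γ i (z, x)).2 - (step A b B S δ γ i (z, x)).1) ^ 2 ≤
        ((1 + γ) * bNorm B (y - x) ^ 2 - γ * d' ^ 2 + beta3 γ ζ * bNorm B (x - z) ^ 2) +
          (2 * δ * ((1 + ζ) * δ - 2)) * sketchLoss A b B S i x +
          (2 * δ * γ * (1 + ζ)) * bInner B (sketchGrad A b B S i x) (z - x) := by
      intro i
      have h1 := bInner_sketchGrad_self (b := b) hB hAS i x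
      have h2 := two_mul_sketchLoss_le hB hS hAS i x hy
      have h3 : bDist B (step A b B S δ γ i (z, x)).2 (feasible A b) ^ 2 ≤
          bNorm B (y - (step A b B S δ γ i (z, x)).2) ^ 2 :=
        pow_le_pow_left₀ (bDist_nonneg _ _) (bDist_le _ hy) 2
      have e1 : y - (step A b B S δ γ i (z, x)).2 =
          (y - x) + δ • sketchGrad A b B S i x + (-γ) • (x - z) := by
        simp only [step, neg_smul]; abel
      have e2 : (step A b B S δ γ i (z, x)).2 - (step A b B S δ γ i (z, x)).1 =
          (-δ) • sketchGrad A b B S i x + γ • (x - z) := by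
        simp only [step, neg_smul]; abel
      have e3 : bInner B (sketchGrad A b B S i x) (z - x) =
          -bInner B (sketchGrad A b B S i x) (x - z) := by
        simp only [bInner_sub_right]; ring
      rw [e1] at h3
      rw [e2, e3]
      simp only [bNorm_sq hB] at h3 hz ⊢
      generalize hw : x - z = w at *
      generalize hv : y - x = v at *
      simp only [bInner_add_left, bInner_add_right, bInner_smul_left, bInner_smul_right, h1,
        bInner_comm hB v (sketchGrad A b B S i x), bInner_comm hB w] at h3 ⊢
      have h4 := mul_le_mul_of_nonneg_left h2 hδ.le
      have h5 := mul_le_mul_of_nonneg_left hz hγ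
      simp only [beta3]
      linarith
    have hsum : expStep A b B S R δ γ
        (fun s => bDist B s.2 (feasible A b) ^ 2 + ζ * bNorm B (s.2 - s.1) ^ 2) (z, x) ≤
        ((1 + γ) * bNorm B (y - x) ^ 2 - γ * d' ^ 2 + beta3 γ ζ * bNorm B (x - z) ^ 2) +
          (2 * δ * ((1 + ζ) * δ - 2)) * expLoss A b B S R x +
          (2 * δ * γ * (1 + ζ)) * bInner B (expGrad A b B S R x) (z - x) := by
      rw [← sum_mul_affine_loss, expGrad, bInner_sum_left, Finset.mul_sum, ← Finset.sum_add_distrib,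
        expStep_apply]
      refine Finset.sum_le_sum fun i _ => ?_
      rw [bInner_smul_left, mul_left_comm (2 * δ * γ * (1 + ζ)), ← mul_add]
      exact mul_le_mul_of_nonneg_left (hi i) ENNReal.toReal_nonneg
    refine hsum.trans ?_
    -- Convexity enters only here: the momentum cross term is at most a multiple of f(z) - f(x). The
    -- total coefficient of f(x) is then nonpositive by `hcoef`, so the lower bound on f applies.
    have c1 := mul_le_mul_of_nonneg_left (hconv x z) (by positivity : 0 ≤ 2 * δ * γ * (1 + ζ))
    have c2 := mul_le_mul_of_nonneg_left (hμ₂ z) (by positivity : 0 ≤ 2 * δ * γ * (1 + ζ))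
    have c3 := mul_le_mul_of_nonneg_left (hμ₁ x)
      (by nlinarith : 0 ≤ 2 * δ * (2 - (1 + ζ) * (δ - γ)))
    simp only [beta2]
    linarith
  have := le_of_forall_bNorm (B := B) hX x (F := fun t => (1 + γ) * t ^ 2 +
    (δ * μ₁ * ((1 + ζ) * (δ - γ) - 2) * d ^ 2 + beta2 μ₂ δ γ ζ * d' ^ 2 +
      beta3 γ ζ * bNorm B (x - z) ^ 2)) (by fun_prop) key
  refine this.trans_eq ?_
  simp only [← hd, beta1]
  ring

end OneStep

/-! ### Parameter sets -/

section Parameters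

variable {μ₁ μ₂ δ γ ζ : ℝ}

lemma sqrt_hR_lt_one (hμ₁ : 0 < μ₁) (hδ : 0 < δ) (hδ2 : δ < 2) : √(hR μ₁ δ) < 1 := by
  rw [Real.sqrt_lt' one_pos, hR]
  have : 0 < (2 * δ - δ ^ 2) * μ₁ := mul_pos (by nlinarith) hμ₁
  linarith

lemma rho2_nonneg (hγ : 0 ≤ γ) : 0 ≤ rho2 μ₁ μ₂ δ γ := by
  unfold rho2; positivity

lemma rho2_lt_one (hμ₁ : 0 < μ₁) (h : (δ, γ) ∈ setQ μ₁ μ₂) : rho2 μ₁ μ₂ δ γ < 1 := by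
  obtain ⟨hδ, hδ2, hγ, hlt⟩ := h
  simp only at hδ hδ2 hγ hlt
  have ha := sqrt_hR_lt_one hμ₁ hδ hδ2
  have ha0 := Real.sqrt_nonneg (hR μ₁ δ)
  have hc : 0 ≤ δ * √μ₂ := by positivity
  rw [rho2]
  generalize √(hR μ₁ δ) = a at *
  generalize δ * √μ₂ = c at *
  rw [lt_div_iff₀ (by linarith)] at hlt
  have h1 : γ < 1 := by nlinarith
  -- After squaring this is γc < (1 - a)(1 - γ), positivity at 1 of the characteristic polynomial,
  -- which is the bound on γ in `setQ`.
  have : √((a - γ) ^ 2 + 4 * γ * c) < 2 - a - γ := by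
    rw [Real.sqrt_lt' (by linarith)]
    nlinarith
  linarith

/-- A nonnegative left eigenvector of the comparison matrix, normalised in its first entry. -/
lemma exists_rho2_weight (hγ : 0 ≤ γ) (hδ : 0 < δ) (hμ₂ : 0 < μ₂) :
    ∃ t, 0 ≤ t ∧ √(hR μ₁ δ) + t * (δ * √μ₂) ≤ rho2 μ₁ μ₂ δ γ ∧
      γ + t * γ ≤ rho2 μ₁ μ₂ δ γ * t := by
  have hc : 0 < δ * √μ₂ := by positivity
  have ha0 := Real.sqrt_nonneg (hR μ₁ δ)
  have hr : rho2 μ₁ μ₂ δ γ = (√(hR μ₁ δ) + γ + √((√(hR μ₁ δ) - γ) ^ 2 + 4 * γ * (δ * √μ₂))) / 2 :=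
    rfl
  generalize rho2 μ₁ μ₂ δ γ = r at *
  generalize √(hR μ₁ δ) = a at *
  generalize δ * √μ₂ = c at *
  have hs : √((a - γ) ^ 2 + 4 * γ * c) ^ 2 = (a - γ) ^ 2 + 4 * γ * c := Real.sq_sqrt (by positivity)
  have hra : a ≤ r := by
    have : |a - γ| ≤ √((a - γ) ^ 2 + 4 * γ * c) := by
      apply Real.abs_le_sqrt; nlinarith [mul_nonneg hγ hc.le]
    linarith [le_abs_self (a - γ)]
  have hchar : (r - γ) * (r - a) = γ * c := by
    rw [hr]; linear_combination hs / 4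
  -- The weight solves the first eigenvector equation; the second then follows from the
  -- characteristic equation `hchar`.
  refine ⟨(r - a) / c, div_nonneg (by linarith) hc.le, ?_, ?_⟩
  · rw [div_mul_cancel₀ _ hc.ne']; linarith
  · have : γ = (r - γ) * ((r - a) / c) := by field_simp; linarith
    linarith

lemma zeta_pos (h : (δ, γ, ζ) ∈ setR) : 0 < ζ := by
  obtain ⟨-, -, hζ, hγ, hlt⟩ := h
  simp only at hζ hγ hlt
  rcases hζ.eq_or_lt with h0 | h0
  · simp [← h0] at hlt; linarith
  · exact h0

lemma beta3_div_nonneg (h : (δ, γ, ζ) ∈ setR) : 0 ≤ beta3 γ ζ / ζ := by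
  have hζ := zeta_pos h
  have hγ : 0 ≤ γ := h.2.2.2.1
  unfold beta3; positivity

lemma beta3_div_lt_one (h : (δ, γ, ζ) ∈ setR) : beta3 γ ζ / ζ < 1 := by
  have hζ := zeta_pos h
  obtain ⟨-, -, -, hγ, hlt⟩ := h
  simp only at hγ hlt
  rw [lt_div_iff₀ (by linarith)] at hlt
  rw [div_lt_one hζ, beta3]
  nlinarith

lemma coefficient_lt (hμ₁ : 0 < μ₁) (hμ₂ : 0 < μ₂) (hR : (δ, γ, ζ) ∈ setR)
    (hS : (δ, γ, ζ) ∈ setS μ₁ μ₂) : (1 + ζ) * (δ - γ) < 2 := by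
  have hζ := zeta_pos hR
  obtain ⟨-, -, -, hγ, -⟩ := hR
  have h1 := hS.1
  simp only at hγ h1
  have h0 : 0 ≤ γ * μ₂ / μ₁ := by positivity
  have h2 : 0 < 2 / (1 + ζ) - δ + γ := lt_of_le_of_lt h0 h1
  have h3 : 0 < (2 / (1 + ζ) - δ + γ) * (1 + ζ) := by positivity
  have h4 : 2 / (1 + ζ) * (1 + ζ) = 2 := div_mul_cancel₀ _ (by positivity)
  linarith

/-- The upper inequality of `setS` with denominators cleared. -/
lemma beta1_nonneg (hμ₁ : 0 < μ₁) (hR : (δ, γ, ζ) ∈ setR) (hS : (δ, γ, ζ) ∈ setS μ₁ μ₂) :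
    0 ≤ beta1 μ₁ δ γ ζ := by
  have hζ := zeta_pos hR
  have hδ : 0 < δ := hR.1
  have h1 := hS.2
  simp only at h1
  rw [le_div_iff₀ (by positivity)] at h1
  have h4 : 2 / (1 + ζ) * (1 + ζ) = 2 := div_mul_cancel₀ _ (by positivity)
  have e : (2 / (1 + ζ) - δ + γ) * (δ * μ₁ * (1 + ζ)) = δ * μ₁ * (2 - (1 + ζ) * (δ - γ)) := by
    linear_combination (δ * μ₁) * h4
  rw [e] at h1
  unfold beta1
  linarith

/-- The lower inequality of `setS`, multiplied by δ μ₁ (1 + ζ). -/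
lemma beta1_add_beta2_lt_one (hμ₁ : 0 < μ₁) (hR : (δ, γ, ζ) ∈ setR)
    (hS : (δ, γ, ζ) ∈ setS μ₁ μ₂) : beta1 μ₁ δ γ ζ + beta2 μ₂ δ γ ζ < 1 := by
  have hζ := zeta_pos hR
  have hδ : 0 < δ := hR.1
  have h1 := hS.1
  simp only at h1
  rw [div_lt_iff₀ hμ₁] at h1
  have h4 : 2 / (1 + ζ) * (1 + ζ) = 2 := div_mul_cancel₀ _ (by positivity)
  have h5 := mul_lt_mul_of_pos_left h1 (by positivity : 0 < δ * (1 + ζ))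
  have e : δ * (1 + ζ) * ((2 / (1 + ζ) - δ + γ) * μ₁) = δ * μ₁ * (2 - (1 + ζ) * (δ - γ)) := by
    linear_combination (δ * μ₁) * h4
  rw [e] at h5
  unfold beta1 beta2
  linarith

lemma beta2_nonneg (hγ : 0 ≤ γ) (h : ¬ δ * μ₂ * (1 + ζ) ≤ 1) : 0 ≤ beta2 μ₂ δ γ ζ :=
  mul_nonneg hγ (by linarith)

lemma alphaC_nonneg : 0 ≤ alphaC μ₁ μ₂ δ γ ζ := by
  unfold alphaC
  split_ifs <;> exact le_max_left _ _

lemma rhoC_nonneg (h : (δ, γ, ζ) ∈ setR) : 0 ≤ rhoC μ₁ μ₂ δ γ ζ := by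
  unfold rhoC
  split_ifs
  · exact (beta3_div_nonneg h).trans (le_max_right _ _)
  · exact (beta3_div_nonneg h).trans (le_max_left _ _)

lemma rhoC_lt_one (hμ₁ : 0 < μ₁) (hR : (δ, γ, ζ) ∈ setR) (hS : (δ, γ, ζ) ∈ setS μ₁ μ₂) :
    rhoC μ₁ μ₂ δ γ ζ < 1 := by
  have h1 := beta1_add_beta2_lt_one hμ₁ hR hS
  unfold rhoC
  split_ifs with h
  · exact max_lt h1 (beta3_div_lt_one hR)
  · have h2 := beta2_nonneg hR.2.2.2.1 h
    refine max_lt (beta3_div_lt_one hR) ?_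
    -- The larger root of t² - β₁t - β₂ lies below 1 because the polynomial is positive at 1 and β₁
    -- < 2.
    have : √(beta1 μ₁ δ γ ζ ^ 2 + 4 * beta2 μ₂ δ γ ζ) < 2 - beta1 μ₁ δ γ ζ := by
      rw [Real.sqrt_lt' (by linarith)]
      nlinarith
    linarith

lemma beta3_le_rhoC_mul (h : (δ, γ, ζ) ∈ setR) : beta3 γ ζ ≤ rhoC μ₁ μ₂ δ γ ζ * ζ := by
  rw [← div_le_iff₀ (zeta_pos h)]
  unfold rhoC
  split_ifs
  · exact le_max_right _ _
  · exact le_max_left _ _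

end Parameters

/-! ### Rates -/

/-- A second-order recursion with a nonpositive lagged coefficient decays at the rate obtained by
ignoring the lag. -/
lemma le_pow_mul_of_lagged {F U : ℕ → ℝ} {ρ c : ℝ} (hρ0 : 0 ≤ ρ) (hρ1 : ρ ≤ 1) (hc : 0 ≤ c)
    (hF : ∀ j, 0 ≤ F j) (hFU : ∀ j, F j ≤ U j) (h0 : U 0 ≤ F 0) (h1 : U 1 ≤ ρ * U 0)
    (hstep : ∀ j, U (j + 2) ≤ ρ * U (j + 1) + c * (F (j + 1) - F j)) (j : ℕ) :
    F j ≤ ρ ^ j * F 0 := by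
  have key : ∀ j, U (j + 1) ≤ ρ ^ (j + 1) * F 0 + c * (F j - ρ ^ j * F 0) := by
    intro j
    induction j with
    | zero => simpa using h1.trans (mul_le_mul_of_nonneg_left h0 hρ0)
    | succ j ih =>
      have h2 := mul_le_mul_of_nonneg_left ih hρ0
      have h3 : 0 ≤ c * (1 - ρ) * F j := mul_nonneg (mul_nonneg hc (by linarith)) (hF j)
      have h4 := hstep j
      rw [pow_succ ρ (j + 1), pow_succ ρ j] at *
      linarith
  induction j with
  | zero => simp
  | succ j ih =>
    have h2 : c * (F j - ρ ^ j * F 0) ≤ 0 := mul_nonpos_of_nonneg_of_nonpos hc (by linarith)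
    linarith [hFU (j + 1), key j]

section Rates

variable {m n q : ℕ} {A : Matrix (Fin m) (Fin n) ℝ} {b : Fin m → ℝ}
  {B : Matrix (Fin n) (Fin n) ℝ} {S : Fin q → Fin m → ℝ} {R : SamplingRule n q} {δ γ : ℝ}

lemma bNorm_zero : bNorm B 0 = 0 := by simp [bNorm, bInner]

theorem expStep_pow_bDist_le (hB : B.PosDef) (hS : ∀ i j, 0 ≤ S i j) (hAS : ∀ i, Aᵀ *ᵥ S i ≠ 0)
    (hX : (feasible A b).Nonempty) {μ₁ μ₂ : ℝ} (hμ₂ : 0 < μ₂)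
    (hμ : ∀ x, μ₁ / 2 * bDist B x (feasible A b) ^ 2 ≤ expLoss A b B S R x ∧
      expLoss A b B S R x ≤ μ₂ / 2 * bDist B x (feasible A b) ^ 2)
    (hQ : (δ, γ) ∈ setQ μ₁ μ₂) (x₀ : Fin n → ℝ) (k : ℕ) :
    (expStep A b B S R δ γ ^ k) (fun s => bDist B s.2 (feasible A b)) (x₀, x₀) ≤
      rho2 μ₁ μ₂ δ γ ^ k * bDist B x₀ (feasible A b) := by
  obtain ⟨hδ, hδ2, hγ, -⟩ := hQ
  simp only at hδ hδ2 hγ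
  obtain ⟨t, ht, ht1, ht2⟩ := exists_rho2_weight (μ₁ := μ₁) hγ hδ hμ₂
  set D : (Fin n → ℝ) × (Fin n → ℝ) → ℝ := fun s => bDist B s.2 (feasible A b) with hD
  set N : (Fin n → ℝ) × (Fin n → ℝ) → ℝ := fun s => bNorm B (s.2 - s.1) with hN
  have hstep : expStep A b B S R δ γ (D + t • N) ≤ rho2 μ₁ μ₂ δ γ • (D + t • N) := by
    intro s
    have h1 := expStep_bDist_le hB hS hAS hX (fun x => (hμ x).1) hδ hδ2 hγ s
    have h2 := mul_le_mul_of_nonneg_left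
      (expStep_bNorm_le hB hAS (fun x => (hμ x).2) hδ hγ s) ht
    have h3 := mul_le_mul_of_nonneg_right ht1 (bDist_nonneg (B := B) s.2 (feasible A b))
    have h4 := mul_le_mul_of_nonneg_right ht2 (bNorm_nonneg (B := B) (s.2 - s.1))
    rw [map_add, map_smul]
    simp only [Pi.add_apply, Pi.smul_apply, smul_eq_mul, hD, hN]
    linarith
  have h := pow_mul_of_expStep_le (rho2_nonneg hγ) hstep k (x₀, x₀)
  have hle : D ≤ D + t • N := fun s => by
    simpa [hN] using mul_nonneg ht (bNorm_nonneg (B := B) (s.2 - s.1))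
  refine (expStep_pow_mono hle k _).trans (h.trans_eq ?_)
  simp [hD, hN, bNorm_zero]

theorem expStep_pow_sq_bDist_le (hB : B.PosDef) (hS : ∀ i j, 0 ≤ S i j)
    (hAS : ∀ i, Aᵀ *ᵥ S i ≠ 0) (hX : (feasible A b).Nonempty) (hconv : IsConvexRule A b B S R)
    {μ₁ μ₂ ζ : ℝ} (hμ₁ : 0 < μ₁) (hμ₂ : 0 < μ₂)
    (hμ : ∀ x, μ₁ / 2 * bDist B x (feasible A b) ^ 2 ≤ expLoss A b B S R x ∧
      expLoss A b B S R x ≤ μ₂ / 2 * bDist B x (feasible A b) ^ 2)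
    (hR : (δ, γ, ζ) ∈ setR) (hSS : (δ, γ, ζ) ∈ setS μ₁ μ₂) (x₀ : Fin n → ℝ) (k : ℕ) :
    (expStep A b B S R δ γ ^ k) (fun s => bDist B s.2 (feasible A b) ^ 2) (x₀, x₀) ≤
      (1 + alphaC μ₁ μ₂ δ γ ζ) * rhoC μ₁ μ₂ δ γ ζ ^ k * bDist B x₀ (feasible A b) ^ 2 := by
  have hζ := zeta_pos hR
  have hδ : 0 < δ := hR.1
  have hγ : 0 ≤ γ := hR.2.2.2.1
  have hρ0 := rhoC_nonneg (μ₁ := μ₁) (μ₂ := μ₂) hR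
  have hρ1 := rhoC_lt_one hμ₁ hR hSS
  have hα := alphaC_nonneg (μ₁ := μ₁) (μ₂ := μ₂) (δ := δ) (γ := γ) (ζ := ζ)
  have hβ3 := beta3_le_rhoC_mul (μ₁ := μ₁) (μ₂ := μ₂) hR
  set ρ := rhoC μ₁ μ₂ δ γ ζ with hρ
  set α := alphaC μ₁ μ₂ δ γ ζ with hα'
  set D : (Fin n → ℝ) × (Fin n → ℝ) → ℝ := fun s => bDist B s.2 (feasible A b) ^ 2 with hD
  set D' : (Fin n → ℝ) × (Fin n → ℝ) → ℝ := fun s => bDist B s.1 (feasible A b) ^ 2 with hD'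
  set N : (Fin n → ℝ) × (Fin n → ℝ) → ℝ := fun s => bNorm B (s.2 - s.1) ^ 2 with hN
  have hD0 : 0 ≤ D := fun s => sq_nonneg _
  have hD'0 : 0 ≤ D' := fun s => sq_nonneg _
  have hN0 : 0 ≤ N := fun s => sq_nonneg _
  have hle : D ≤ D + ζ • N := fun s => by simpa using mul_nonneg hζ.le (hN0 s)
  have hN00 : N (x₀, x₀) = 0 := by simp [hN, bNorm_zero]
  have hTD' : expStep A b B S R δ γ D' = D :=
    expStep_fst fun x => bDist B x (feasible A b) ^ 2
  have henergy : ∀ s, expStep A b B S R δ γ (D + ζ • N) s ≤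
      beta1 μ₁ δ γ ζ * D s + beta2 μ₂ δ γ ζ * D' s + beta3 γ ζ * N s := fun s =>
    expStep_energy_le hB hS hAS hX hconv (fun x => (hμ x).1) (fun x => (hμ x).2) hδ hγ hζ.le
      (coefficient_lt hμ₁ hμ₂ hR hSS).le s
  by_cases hcase : δ * μ₂ * (1 + ζ) ≤ 1
  · have hb2 : 0 ≤ -beta2 μ₂ δ γ ζ := by
      unfold beta2
      nlinarith [mul_nonneg hγ (sub_nonneg.2 hcase)]
    have hb12 : beta1 μ₁ δ γ ζ + beta2 μ₂ δ γ ζ ≤ ρ := by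
      rw [hρ, rhoC, if_pos hcase]; exact le_max_left _ _
    -- Here β₁D + β₂D' is written as (β₁ + β₂)D + (-β₂)(D - D'), the form `le_pow_mul_of_lagged`
    -- accepts.
    have hstep : expStep A b B S R δ γ (D + ζ • N) ≤
        ρ • (D + ζ • N) + (-beta2 μ₂ δ γ ζ) • (D - D') := by
      intro s
      have h1 := mul_le_mul_of_nonneg_right hb12 (hD0 s)
      have h2 := mul_le_mul_of_nonneg_right hβ3 (hN0 s)
      have h3 := henergy s
      simp only [Pi.add_apply, Pi.sub_apply, Pi.smul_apply, smul_eq_mul] at *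
      linarith
    have hpow : ∀ j, (expStep A b B S R δ γ ^ (j + 1)) (D + ζ • N) (x₀, x₀) ≤
        ρ * (expStep A b B S R δ γ ^ j) (D + ζ • N) (x₀, x₀) +
          -beta2 μ₂ δ γ ζ * ((expStep A b B S R δ γ ^ j) D (x₀, x₀) -
            (expStep A b B S R δ γ ^ j) D' (x₀, x₀)) := by
      intro j
      have h1 := expStep_pow_mono (A := A) (b := b) (B := B) (S := S) (R := R) (δ := δ) (γ := γ)
        hstep j (x₀, x₀)
      rw [expStep_pow_succ_apply]
      refine h1.trans_eq ?_
      simp only [map_add, map_sub, map_smul, Pi.add_apply, Pi.sub_apply, Pi.smul_apply,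
        smul_eq_mul]
    have hmain := le_pow_mul_of_lagged
      (F := fun j => (expStep A b B S R δ γ ^ j) D (x₀, x₀))
      (U := fun j => (expStep A b B S R δ γ ^ j) (D + ζ • N) (x₀, x₀)) hρ0 hρ1.le hb2
      (fun j => expStep_pow_nonneg hD0 j _) (fun j => expStep_pow_mono hle j _)
      -- Since x₁ = x₀, the step length and the lag D - D' both vanish at the start.
      (by simp [hN00]) (by simpa [hD, hD'] using hpow 0)
      (fun j => by
        have h := hpow (j + 1)
        rwa [expStep_pow_succ_apply j D', hTD'] at h) k
    refine hmain.trans ?_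
    have h0 : (expStep A b B S R δ γ ^ 0) D (x₀, x₀) = bDist B x₀ (feasible A b) ^ 2 := by simp [hD]
    simp only [h0]
    gcongr
    exact le_mul_of_one_le_left (pow_nonneg hρ0 k) (by linarith)
  · have hb2 := beta2_nonneg (δ := δ) (μ₂ := μ₂) (ζ := ζ) hγ hcase
    have hb1 := beta1_nonneg hμ₁ hR hSS
    have hr : (beta1 μ₁ δ γ ζ + √(beta1 μ₁ δ γ ζ ^ 2 + 4 * beta2 μ₂ δ γ ζ)) / 2 ≤ ρ := by
      rw [hρ, rhoC, if_neg hcase]; exact le_max_right _ _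
    have hs : √(beta1 μ₁ δ γ ζ ^ 2 + 4 * beta2 μ₂ δ γ ζ) ^ 2 =
      beta1 μ₁ δ γ ζ ^ 2 + 4 * beta2 μ₂ δ γ ζ := Real.sq_sqrt (by positivity)
    have hs1 : beta1 μ₁ δ γ ζ ≤ √(beta1 μ₁ δ γ ζ ^ 2 + 4 * beta2 μ₂ δ γ ζ) :=
      Real.le_sqrt_of_sq_le (by linarith)
    -- The nonzero entries in the maximum for α are those for ρ minus β₁, and the entry 0 is
    -- redundant because the root is at least β₁.
    have hαρ : α = ρ - beta1 μ₁ δ γ ζ := by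
      rw [hα', hρ, alphaC, rhoC, if_neg hcase, if_neg hcase, ← max_sub_sub_right]
      have e : (-beta1 μ₁ δ γ ζ + √(beta1 μ₁ δ γ ζ ^ 2 + 4 * beta2 μ₂ δ γ ζ)) / 2 =
        (beta1 μ₁ δ γ ζ + √(beta1 μ₁ δ γ ζ ^ 2 + 4 * beta2 μ₂ δ γ ζ)) / 2 - beta1 μ₁ δ γ ζ := by
        ring
      rw [e]
      exact max_eq_right (le_max_of_le_right (by linarith))
    have hprod : beta2 μ₂ δ γ ζ ≤ ρ * α := by
      rw [hαρ]
      generalize √(beta1 μ₁ δ γ ζ ^ 2 + 4 * beta2 μ₂ δ γ ζ) = w at *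
      nlinarith
    -- Coefficients compare termwise: β₁ + α = ρ on D, β₂ ≤ ρα on D' and β₃ ≤ ρζ on N. At the start
    -- D = D' and N = 0, whence the factor 1 + α.
    have hstep : expStep A b B S R δ γ (D + ζ • N + α • D') ≤ ρ • (D + ζ • N + α • D') := by
      intro s
      have h2 := mul_le_mul_of_nonneg_right hβ3 (hN0 s)
      have h4 := mul_le_mul_of_nonneg_right hprod (hD'0 s)
      have h3 := henergy s
      rw [map_add, map_smul, hTD']
      simp only [Pi.add_apply, Pi.smul_apply, smul_eq_mul] at *
      rw [hαρ] at *
      linarith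
    have h := pow_mul_of_expStep_le hρ0 hstep k (x₀, x₀)
    have hle' : D ≤ D + ζ • N + α • D' :=
      hle.trans (le_add_of_nonneg_right (smul_nonneg hα hD'0))
    refine (expStep_pow_mono hle' k _).trans (h.trans_eq ?_)
    simp only [Pi.add_apply, Pi.smul_apply, smul_eq_mul, hN00, hD, hD']
    ring

end Rates

/-! ### Basic solutions and their size -/

section Basic

variable {m n : ℕ}

/-- A feasible point that is pinned down by its active constraints and vanishing coordinates. -/
lemma exists_basic_feasible {A : Matrix (Fin m) (Fin n) ℝ} {b : Fin m → ℝ}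
    (hX : (feasible A b).Nonempty) :
    ∃ x ∈ feasible A b, ∀ v : Fin n → ℝ, (∀ i, (A *ᵥ x) i = b i → (A *ᵥ v) i = 0) →
      (∀ j, x j = 0 → v j = 0) → v = 0 := by
  classical
  -- Vanishing coordinates count as constraints because a polyhedron containing a line has no
  -- vertex. A point with the most active constraints will do.
  let act : (Fin n → ℝ) → Finset (Fin m ⊕ Fin n) := fun x =>
    Finset.univ.filter fun k => Sum.elim (fun i => (A *ᵥ x) i = b i) (fun j => x j = 0) k
  obtain ⟨x, hx, hmax⟩ : ∃ x ∈ feasible A b, ∀ y ∈ feasible A b, ¬ (act x).card < (act y).card := by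
    have hfin : ((fun x => (act x).card) '' feasible A b).Finite :=
      (Set.finite_Iic (Fintype.card (Fin m ⊕ Fin n))).subset (by
        rintro _ ⟨y, -, rfl⟩; exact Finset.card_le_univ _)
    obtain ⟨c, ⟨x, hx, rfl⟩, hc⟩ := Set.exists_max_image _ id hfin (hX.image _)
    exact ⟨x, hx, fun y hy => not_lt.2 (hc _ ⟨y, hy, rfl⟩)⟩
  refine ⟨x, hx, fun v hva hvz => ?_⟩
  by_contra hv
  obtain ⟨j₀, hj₀⟩ := Function.ne_iff.1 hv
  simp only [Pi.zero_apply] at hj₀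
  have hxj₀ : x j₀ ≠ 0 := fun h => hj₀ (hvz _ h)
  -- Scaled so that coordinate j₀ reaches zero at time 1.
  set w : Fin n → ℝ := (-(x j₀ / v j₀)) • v with hw
  have hwa : ∀ i, (A *ᵥ x) i = b i → (A *ᵥ w) i = 0 := fun i hi => by
    rw [hw, Matrix.mulVec_smul, Pi.smul_apply, hva i hi, smul_zero]
  have hwz : ∀ j, x j = 0 → w j = 0 := fun j hj => by simp [hw, hvz j hj]
  have hwj₀ : x j₀ + w j₀ = 0 := by simp only [hw, Pi.smul_apply, smul_eq_mul]; field_simp; simp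
  -- Events along the ray: `none` is the vanishing of coordinate j₀, `some i` the moment row i
  -- becomes tight. Stopping at the earliest keeps feasibility and enlarges the active set.
  let T : Finset (Option (Fin m)) := Finset.univ.filter fun o => ∀ i ∈ o, 0 < (A *ᵥ w) i
  let τ : Option (Fin m) → ℝ := fun o => o.elim 1 fun i => (b i - (A *ᵥ x) i) / (A *ᵥ w) i
  obtain ⟨o, ho, hmin⟩ := T.exists_min_image τ ⟨none, by simp [T]⟩
  have hpos : ∀ i, 0 < (A *ᵥ w) i → (A *ᵥ x) i ≠ b i := fun i hi h => hi.ne' (hwa i h)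
  have hτ : 0 < τ o := by
    cases o with
    | none => simp [τ]
    | some i =>
      have hi : 0 < (A *ᵥ w) i := by simpa [T] using ho
      exact div_pos (sub_pos.2 (lt_of_le_of_ne (hx i) (hpos i hi))) hi
  have hAy : ∀ i, (A *ᵥ (x + τ o • w)) i = (A *ᵥ x) i + τ o * (A *ᵥ w) i := fun i => by
    simp [Matrix.mulVec_add, Matrix.mulVec_smul]
  have hy : x + τ o • w ∈ feasible A b := by
    intro i
    rw [hAy]
    rcases le_or_gt ((A *ᵥ w) i) 0 with hi | hi
    · nlinarith [hx i]
    · have := hmin (some i) (by simpa [T] using hi)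
      simp only [τ, Option.elim_some] at this
      rw [le_div_iff₀ hi] at this
      linarith
  have hsub : act x ⊆ act (x + τ o • w) := by
    intro k hk
    simp only [act, Finset.mem_filter, Finset.mem_univ, true_and] at hk ⊢
    cases k with
    | inl i => simp only [Sum.elim_inl] at hk ⊢; rw [hAy, hwa i hk, hk]; simp
    | inr j => simp only [Sum.elim_inr] at hk ⊢; simp [hk, hwz j hk]
  refine hmax _ hy (Finset.card_lt_card (Finset.ssubset_iff_subset_ne.2 ⟨hsub, fun he => ?_⟩))
  cases o with
  | none =>
    have h1 : Sum.inr j₀ ∈ act (x + τ none • w) := by simp [act, τ, hwj₀]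
    rw [← he] at h1
    exact hxj₀ (by simpa [act] using h1)
  | some i =>
    have hi : 0 < (A *ᵥ w) i := by simpa [T] using ho
    have h1 : Sum.inl i ∈ act (x + τ (some i) • w) := by
      simp only [act, Finset.mem_filter, Finset.mem_univ, true_and, Sum.elim_inl]
      rw [hAy]
      simp only [τ, Option.elim_some, div_mul_cancel₀ _ hi.ne']
      ring
    rw [← he] at h1
    exact hpos i hi (by simpa [act] using h1)

/-- A matrix with trivial kernel has an invertible square submatrix made of some of its rows. -/
lemma exists_submatrix_det_ne_zero {ι : Type*} [Fintype ι] (M : Matrix ι (Fin n) ℝ)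
    (hM : ∀ v, M *ᵥ v = 0 → v = 0) :
    ∃ f : Fin n → ι, Function.Injective f ∧ (M.submatrix f id).det ≠ 0 := by
  obtain ⟨κ, a, ha, hsp, hli⟩ := exists_linearIndependent' ℝ M.row
  have : Finite κ := Finite.of_injective a ha
  have : Fintype κ := Fintype.ofFinite κ
  have hrank : M.rank = n := by
    rw [Matrix.rank, LinearMap.finrank_range_of_inj, Module.finrank_fin_fun]
    rw [← LinearMap.ker_eq_bot]
    exact (Submodule.eq_bot_iff _).2 fun v hv => hM v (by simpa using hv)
  have hcard : Fintype.card κ = Fintype.card (Fin n) := by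
    rw [← finrank_span_eq_card hli, hsp, ← Matrix.rank_eq_finrank_span_row, hrank, Fintype.card_fin]
  let e := (Fintype.equivOfCardEq hcard).symm
  refine ⟨a ∘ e, ha.comp e.injective, ?_⟩
  have hli' := hli.comp e e.injective
  have hu : IsUnit (M.submatrix (a ∘ e) id) :=
    Matrix.linearIndependent_rows_iff_isUnit.1 hli'
  exact ((Matrix.isUnit_iff_isUnit_det _).1 hu).ne_zero

/-- Expanding the product of row sums gives one term per self-map of the index set; the Leibniz
formula uses only the permutations. -/
lemma abs_det_le_prod_sum {n : ℕ} (M : Matrix (Fin n) (Fin n) ℝ) :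
    |M.det| ≤ ∏ k, ∑ j, |M k j| := by
  classical
  rw [← Matrix.det_transpose, Matrix.det_apply, Finset.prod_univ_sum]
  calc |∑ σ : Equiv.Perm (Fin n), Equiv.Perm.sign σ • ∏ i, Mᵀ (σ i) i|
      ≤ ∑ σ : Equiv.Perm (Fin n), |Equiv.Perm.sign σ • ∏ i, Mᵀ (σ i) i| :=
        Finset.abs_sum_le_sum_abs _ _
    _ = ∑ σ : Equiv.Perm (Fin n), ∏ i, |M i (σ i)| := by
        refine Finset.sum_congr rfl fun σ _ => ?_
        rcases Int.units_eq_one_or (Equiv.Perm.sign σ) with h | h <;>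
          simp [h, Finset.abs_prod]
    _ = ∑ p ∈ Finset.univ.map ⟨fun σ : Equiv.Perm (Fin n) => (σ : Fin n → Fin n),
          Equiv.coe_fn_injective⟩, ∏ i, |M i (p i)| := by simp
    _ ≤ _ := Finset.sum_le_sum_of_subset_of_nonneg
        (fun p _ => by simp) (fun p _ _ => Finset.prod_nonneg fun i _ => abs_nonneg _)

/-- The size of a rational number: the product whose binary logarithm is its bit length. -/
def ratSize (r : ℚ) : ℝ := (|(r.num : ℝ)| + 1) * r.den

lemma one_le_den (r : ℚ) : (1 : ℝ) ≤ r.den := by exact_mod_cast r.pos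

lemma ratSize_pos (r : ℚ) : 0 < ratSize r :=
  mul_pos (by positivity) (by linarith [one_le_den r])

lemma one_le_ratSize (r : ℚ) : 1 ≤ ratSize r :=
  one_le_mul_of_one_le_of_one_le (le_add_of_nonneg_left (abs_nonneg _)) (one_le_den r)

lemma abs_cast_le (r : ℚ) : |(r : ℝ)| ≤ |(r.num : ℝ)| := by
  rw [Rat.cast_def, abs_div, Nat.abs_cast]
  exact div_le_self (abs_nonneg _) (one_le_den r)

lemma den_mul_one_add_abs_le (r : ℚ) : (r.den : ℝ) * (1 + |(r : ℝ)|) ≤ ratSize r := by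
  rw [ratSize, mul_comm]
  exact mul_le_mul_of_nonneg_right (by linarith [abs_cast_le r]) (Nat.cast_nonneg _)

lemma one_add_abs_le (r : ℚ) : 1 + |(r : ℝ)| ≤ ratSize r := by
  refine le_trans ?_ (den_mul_one_add_abs_le r)
  exact le_mul_of_one_le_left (by positivity) (one_le_den r)

lemma two_rpow_ratBits (r : ℚ) : (2 : ℝ) ^ ratBits r = ratSize r := by
  have h1 : (0 : ℝ) < |(r.num : ℝ)| + 1 := by positivity
  have h2 : (0 : ℝ) < r.den := by linarith [one_le_den r]
  rw [ratBits, Real.rpow_add two_pos, Real.rpow_logb two_pos (by norm_num) h1,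
    Real.rpow_logb two_pos (by norm_num) h2, ratSize]

lemma two_rpow_encodingLength (hm : 0 < m) (hn : 0 < n) (A : Matrix (Fin m) (Fin n) ℚ)
    (b : Fin m → ℚ) :
    (2 : ℝ) ^ encodingLength A b =
      (∏ i, (∏ j, ratSize (A i j)) * ratSize (b i)) * (m * n) * 4 := by
  have hmn : (0 : ℝ) < (m : ℝ) * n := by positivity
  rw [encodingLength, Real.rpow_add two_pos, Real.rpow_add two_pos, Real.rpow_add two_pos,
    Real.rpow_logb two_pos (by norm_num) hmn, Finset.prod_mul_distrib]
  simp only [Real.rpow_sum_of_pos two_pos, two_rpow_ratBits]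
  norm_num

/-- Integrality bounds a nonzero determinant of a matrix with rational rows from below. -/
lemma one_le_prod_mul_abs_det {n : ℕ} (M : Matrix (Fin n) (Fin n) ℝ) (hM : M.det ≠ 0)
    (D : Fin n → ℝ) (hD : ∀ k, 0 < D k) (N : Matrix (Fin n) (Fin n) ℤ)
    (hN : ∀ k j, D k * M k j = N k j) : 1 ≤ (∏ k, D k) * |M.det| := by
  have e : (N.map (Int.castRingHom ℝ)) = Matrix.of fun k j => D k * M k j := by
    ext k j; simp [hN]
  have h : ((N.det : ℤ) : ℝ) = (∏ k, D k) * M.det := by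
    rw [← Matrix.det_mul_column, ← e, ← RingHom.mapMatrix_apply, ← RingHom.map_det]
    rfl
  have hne : N.det ≠ 0 := by
    intro h0
    rw [h0, Int.cast_zero] at h
    exact mul_ne_zero (Finset.prod_ne_zero_iff.2 fun k _ => (hD k).ne') hM h.symm
  have h1 : (1 : ℝ) ≤ |((N.det : ℤ) : ℝ)| := by exact_mod_cast Int.one_le_abs hne
  rwa [h, abs_mul, abs_of_pos (Finset.prod_pos fun k _ => hD k)] at h1

lemma exists_int_prod_den_mul {ι : Type*} [Fintype ι] (r : ι → ℚ) (j : ι) :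
    ∃ z : ℤ, (∏ l, ((r l).den : ℝ)) * (r j : ℝ) = z := by
  classical
  refine ⟨(∏ l ∈ Finset.univ.erase j, ((r l).den : ℤ)) * (r j).num, ?_⟩
  rw [← Finset.prod_erase_mul _ _ (Finset.mem_univ j), mul_assoc]
  push_cast
  congr 1
  have h : ((r j).den : ℝ) ≠ 0 := by linarith [one_le_den (r j)]
  rw [Rat.cast_def]
  field_simp

lemma one_add_sum_le_prod {ι : Type*} (s : Finset ι) (a : ι → ℝ) (ha : ∀ i, 0 ≤ a i) :
    1 + ∑ i ∈ s, a i ≤ ∏ i ∈ s, (1 + a i) := by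
  classical
  induction s using Finset.induction_on with
  | empty => simp
  | insert i s hi ih =>
    rw [Finset.sum_insert hi, Finset.prod_insert hi]
    nlinarith [ha i, mul_le_mul_of_nonneg_left ih (ha i),
      mul_nonneg (ha i) (Finset.sum_nonneg fun i (_ : i ∈ s) => ha i)]

/-- A nonempty rational polyhedron has a point whose coordinates are bounded by the product of the
sizes of the data. -/
theorem exists_feasible_abs_le (A : Matrix (Fin m) (Fin n) ℚ) (b : Fin m → ℚ)
    (hX : (feasible (realMat A) (realVec b)).Nonempty) :
    ∃ x ∈ feasible (realMat A) (realVec b),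
      ∀ j, |x j| ≤ ∏ i, (∏ j, ratSize (A i j)) * ratSize (b i) := by
  classical
  obtain ⟨x, hx, hbasic⟩ := exists_basic_feasible hX
  refine ⟨x, hx, fun j₀ => ?_⟩
  let K := {k : Fin m ⊕ Fin n // Sum.elim (fun i => (realMat A *ᵥ x) i = realVec b i)
    (fun j => x j = 0) k}
  let row : Fin m ⊕ Fin n → Fin n → ℚ := Sum.elim (fun i j => A i j) (fun j l => if l = j then 1 else 0)
  let rhs : Fin m ⊕ Fin n → ℚ := Sum.elim b 0
  let size : Fin m ⊕ Fin n → ℝ :=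
    Sum.elim (fun i => (∏ j, ratSize (A i j)) * ratSize (b i)) 1
  let M : Matrix K (Fin n) ℝ := Matrix.of fun k j => (row k j : ℝ)
  have hMin : ∀ (i : Fin m) h v, (M *ᵥ v) ⟨Sum.inl i, h⟩ = (realMat A *ᵥ v) i := fun i h v => rfl
  have hMz : ∀ (j : Fin n) h v, (M *ᵥ v) ⟨Sum.inr j, h⟩ = v j := fun j h v => by
    have e : ∑ l, ((if l = j then 1 else 0 : ℚ) : ℝ) * v l = v j := by
      rw [Finset.sum_eq_single j (fun l _ hl => by rw [if_neg hl]; simp) (by simp)]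
      simp
    exact e
  have hMx : ∀ k : K, (M *ᵥ x) k = rhs k := by
    rintro ⟨i | j, h⟩
    · rw [hMin]; exact h
    · rw [hMz]; simpa [rhs] using h
  obtain ⟨f, hf, hdet⟩ := exists_submatrix_det_ne_zero M fun v hv => hbasic v
    (fun i hi => by rw [← hMin i hi, hv]; rfl) (fun j hj => by have := hMz j hj v; rw [← this, hv]; rfl)
  set P := M.submatrix f id with hP
  let c : Fin n → ℝ := fun k => rhs (f k)
  have hPx : P *ᵥ x = c := funext fun k => hMx (f k)
  have hcramer : P.det * x j₀ = (P.updateCol j₀ c).det := by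
    rw [← Matrix.cramer_apply, ← hPx, Matrix.cramer_eq_adjugate_mulVec, Matrix.mulVec_mulVec,
      Matrix.adjugate_mul, Matrix.smul_mulVec, Matrix.one_mulVec]
    rfl
  -- Only denominators of the coefficient rows are cleared: integrality is needed for det P, not for
  -- the numerator in Cramer's rule.
  let D : Fin n → ℝ := fun k => ∏ l, ((row (f k) l).den : ℝ)
  have hD : ∀ k, 0 < D k := fun k =>
    Finset.prod_pos fun l _ => by linarith [one_le_den (row (f k) l)]
  choose N hN using fun k j => exists_int_prod_den_mul (row (f k)) j
  have hlow := one_le_prod_mul_abs_det P hdet D hD (Matrix.of N) fun k j => hN k j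
  have hrow : ∀ k, D k * ∑ j, |P.updateCol j₀ c k j| ≤ size (f k) := by
    intro k
    have hP' : ∀ j, P k j = row (f k) j := fun j => rfl
    have hc : c k = rhs (f k) := rfl
    have hsum : ∑ j, |P.updateCol j₀ c k j| ≤ |(rhs (f k) : ℝ)| + ∑ j, |(row (f k) j : ℝ)| := by
      rw [← Finset.add_sum_erase _ _ (Finset.mem_univ j₀), Matrix.updateCol_self, hc]
      gcongr
      refine (Finset.sum_le_sum_of_subset_of_nonneg (Finset.erase_subset j₀ Finset.univ)
        fun j _ _ => abs_nonneg _).trans' (Finset.sum_le_sum fun j hj => ?_)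
      rw [Matrix.updateCol_ne (Finset.ne_of_mem_erase hj), hP']
    change (∏ l, ((row (f k) l).den : ℝ)) * _ ≤ _
    rcases hfk : (f k : Fin m ⊕ Fin n) with i | j
    · rw [hfk] at hsum
      simp only [row, rhs, size, Sum.elim_inl] at hsum ⊢
      have h1 := one_add_sum_le_prod Finset.univ (fun j => |(A i j : ℝ)|) fun j => abs_nonneg _
      have h2 : ∑ j, |P.updateCol j₀ c k j| ≤ (∏ j, (1 + |(A i j : ℝ)|)) * (1 + |(b i : ℝ)|) := by
        have h3 : 0 ≤ ∑ j, |(A i j : ℝ)| := Finset.sum_nonneg fun j _ => abs_nonneg _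
        nlinarith [abs_nonneg (b i : ℝ), mul_le_mul_of_nonneg_right h1 (abs_nonneg (b i : ℝ))]
      calc _ ≤ (∏ l, ((A i l).den : ℝ)) * ((∏ j, (1 + |(A i j : ℝ)|)) * (1 + |(b i : ℝ)|)) := by
            gcongr
        _ = (∏ j, ((A i j).den : ℝ) * (1 + |(A i j : ℝ)|)) * (1 + |(b i : ℝ)|) := by
            rw [Finset.prod_mul_distrib, mul_assoc]
        _ ≤ _ := by
            gcongr
            · exact Finset.prod_nonneg fun j _ => (ratSize_pos _).le
            · exact den_mul_one_add_abs_le _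
            · exact one_add_abs_le _
    · rw [hfk] at hsum
      simp only [row, rhs, size, Sum.elim_inr, Pi.zero_apply, Rat.cast_zero, abs_zero, zero_add,
        Pi.one_apply] at hsum ⊢
      have h1 : ∑ l, |((if l = j then 1 else 0 : ℚ) : ℝ)| = 1 := by
        rw [Finset.sum_eq_single j] <;> simp +contextual
      have h2 : ∏ l, ((if l = j then 1 else 0 : ℚ).den : ℝ) = 1 :=
        Finset.prod_eq_one fun l _ => by split_ifs <;> simp
      rw [h2, one_mul]
      exact hsum.trans_eq h1
  have hsize : ∀ k, 1 ≤ size k := by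
    rintro (i | j)
    · exact one_le_mul_of_one_le_of_one_le
        (Finset.one_le_prod fun j _ => one_le_ratSize _) (one_le_ratSize _)
    · exact le_rfl
  have hDpos : 0 < ∏ k, D k := Finset.prod_pos fun k _ => hD k
  calc |x j₀| ≤ (∏ k, D k) * |P.det| * |x j₀| := le_mul_of_one_le_left (abs_nonneg _) hlow
    _ = (∏ k, D k) * |(P.updateCol j₀ c).det| := by rw [mul_assoc, ← abs_mul, hcramer]
    _ ≤ (∏ k, D k) * ∏ k, ∑ j, |P.updateCol j₀ c k j| := by
        gcongr; exact abs_det_le_prod_sum _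
    _ = ∏ k, D k * ∑ j, |P.updateCol j₀ c k j| := by rw [Finset.prod_mul_distrib]
    _ ≤ ∏ k, size (f k) := by
        refine Finset.prod_le_prod (fun k _ => ?_) fun k _ => hrow k
        exact mul_nonneg (hD k).le (Finset.sum_nonneg fun j _ => abs_nonneg _)
    _ = ∏ k ∈ Finset.univ.map ⟨fun k => (f k : Fin m ⊕ Fin n), Subtype.val_injective.comp hf⟩,
          size k := by simp
    -- Unselected rows have size at least 1, and coordinate rows size exactly 1, so just the data of
    -- A and b remain.
    _ ≤ ∏ k, size k := Finset.prod_mono_set_of_one_le hsize (Finset.subset_univ _)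
    _ = _ := by simp [size, Fintype.prod_sum_type]

end Basic

/-! ### Violation against distance -/

section Violation

variable {m n : ℕ} {A : Matrix (Fin m) (Fin n) ℝ} {b : Fin m → ℝ} {B : Matrix (Fin n) (Fin n) ℝ}

lemma rowNorm_le_maxRowNorm (i : Fin m) : √(∑ l, A i l ^ 2) ≤ maxRowNorm A :=
  le_ciSup (f := fun j => √(∑ l, A j l ^ 2)) (Set.finite_range _).bddAbove i

lemma maxRowNorm_nonneg : 0 ≤ maxRowNorm A := Real.iSup_nonneg fun _ => Real.sqrt_nonneg _

lemma maxRowNorm_pos (i : Fin m) (hA : A i ≠ 0) : 0 < maxRowNorm A := by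
  refine lt_of_lt_of_le ?_ (rowNorm_le_maxRowNorm i)
  obtain ⟨j, hj⟩ := Function.ne_iff.1 hA
  have : 0 < A i j ^ 2 := by simpa using pow_pos (abs_pos.2 hj) 2
  exact Real.sqrt_pos.2 (this.trans_le
    (Finset.single_le_sum (f := fun l => A i l ^ 2) (fun l _ => sq_nonneg _) (Finset.mem_univ j)))

lemma mulVec_apply_le (i : Fin m) (v : Fin n → ℝ) : (A *ᵥ v) i ≤ maxRowNorm A * √(v ⬝ᵥ v) := by
  have h1 : (A *ᵥ v) i ≤ √(∑ l, A i l ^ 2) * √(v ⬝ᵥ v) := by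
    rw [← Real.sqrt_mul (Finset.sum_nonneg fun l _ => sq_nonneg _)]
    apply Real.le_sqrt_of_sq_le
    simpa [Matrix.mulVec, dotProduct, sq] using
      Finset.sum_mul_sq_le_sq_mul_sq Finset.univ (A i) v
  exact h1.trans (by gcongr; exact rowNorm_le_maxRowNorm i)

lemma maxViolation_le [Nonempty (Fin m)] [NeZero n] (hB : B.PosDef) (hX : (feasible A b).Nonempty)
    (x : Fin n → ℝ) :
    maxViolation A b x ≤ maxRowNorm A / √(sInf (spectrum ℝ B)) * bDist B x (feasible A b) := by
  have hl := Real.sqrt_pos.2 (sInf_spectrum_pos hB)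
  refine le_of_forall_bNorm hX x
    (F := fun t => maxRowNorm A / √(sInf (spectrum ℝ B)) * t) (by fun_prop) fun y hy => ?_
  have hnorm : √((x - y) ⬝ᵥ (x - y)) ≤ bNorm B (y - x) / √(sInf (spectrum ℝ B)) := by
    rw [le_div_iff₀ hl, mul_comm, ← Real.sqrt_mul (sInf_spectrum_pos hB).le, bNorm]
    apply Real.sqrt_le_sqrt
    have := sInf_spectrum_mul_le hB (y - x)
    rwa [← neg_sub x y, neg_dotProduct, dotProduct_neg, neg_neg, neg_sub] at this
  have hψ := maxRowNorm_nonneg (A := A)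
  have hle := mul_le_mul_of_nonneg_left hnorm hψ
  rw [← mul_div_assoc, mul_div_right_comm] at hle
  refine ciSup_le fun i => max_le ?_ ((mul_nonneg hψ (Real.sqrt_nonneg _)).trans hle)
  refine le_trans ?_ ((mulVec_apply_le i (x - y)).trans hle)
  rw [Matrix.mulVec_sub, Pi.sub_apply]
  linarith [hy i]

/-- A multiple of a_i violates row i by exactly 1. Such a point forces μ₁ ≤ μ₂, hence μ₂ > 0. -/
lemma exists_bDist_pos [NeZero n] (hB : B.PosDef) (hX : (feasible A b).Nonempty) (i : Fin m)
    (hA : A i ≠ 0) : ∃ x, 0 < bDist B x (feasible A b) := by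
  have : Nonempty (Fin m) := ⟨i⟩
  have hs : 0 < A i ⬝ᵥ A i := by
    refine lt_of_le_of_ne (Finset.sum_nonneg fun l _ => mul_self_nonneg _) fun h => hA ?_
    exact dotProduct_self_eq_zero.1 h.symm
  set t := (b i + 1) / (A i ⬝ᵥ A i) with ht
  have hx : (A *ᵥ (t • A i)) i = b i + 1 := by
    change A i ⬝ᵥ (t • A i) = _
    rw [dotProduct_smul, smul_eq_mul, ht, div_mul_cancel₀ _ hs.ne']
  refine ⟨t • A i, (bDist_nonneg _ _).lt_of_ne' fun h0 => ?_⟩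
  have h1 := maxViolation_le hB hX (t • A i)
  have h2 : max ((A *ᵥ (t • A i)) i - b i) 0 ≤ maxViolation A b (t • A i) :=
    le_ciSup (f := fun k => max ((A *ᵥ (t • A i)) k - b k) 0) (Set.finite_range _).bddAbove i
  rw [h0, mul_zero] at h1
  have h3 := le_max_left ((A *ᵥ (t • A i)) i - b i) 0
  rw [hx] at h2 h3
  linarith

end Violation

lemma bDist_zero_le {m n : ℕ} [NeZero n] (hm : 0 < m) (A : Matrix (Fin m) (Fin n) ℚ)
    (b : Fin m → ℚ) (hX : (feasible (realMat A) (realVec b)).Nonempty)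
    {B : Matrix (Fin n) (Fin n) ℝ} (hB : B.PosDef) :
    bDist B 0 (feasible (realMat A) (realVec b)) ≤
      √(sSup (spectrum ℝ B)) * ((2 : ℝ) ^ (encodingLength A b - 1) / √n) := by
  obtain ⟨x, hx, hbound⟩ := exists_feasible_abs_le A b hX
  have hn : 0 < n := NeZero.pos n
  have hσ := two_rpow_encodingLength hm hn A b
  set P := ∏ i, (∏ j, ratSize (A i j)) * ratSize (b i) with hP
  have hn' : (0 : ℝ) < n := by exact_mod_cast hn
  have hm' : (1 : ℝ) ≤ m := by exact_mod_cast hm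
  have hP0 : 0 ≤ P := Finset.prod_nonneg fun i _ =>
    mul_nonneg (Finset.prod_nonneg fun j _ => (ratSize_pos _).le) (ratSize_pos _).le
  have hdot : x ⬝ᵥ x ≤ n * P ^ 2 := by
    calc x ⬝ᵥ x ≤ ∑ _j : Fin n, P ^ 2 := Finset.sum_le_sum fun j _ => by
          rw [← sq, ← sq_abs]; gcongr; exact hbound j
      _ = n * P ^ 2 := by simp
  -- Here 2^(σ-1) = 2Pmn, so the term log₂(mn) in σ pays for both factors √n.
  have hle : P * √n ≤ (2 : ℝ) ^ (encodingLength A b - 1) / √n := by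
    rw [le_div_iff₀ (Real.sqrt_pos.2 hn'), mul_assoc, Real.mul_self_sqrt hn'.le,
      Real.rpow_sub two_pos, hσ, Real.rpow_one]
    nlinarith [mul_nonneg hP0 hn'.le]
  calc bDist B 0 (feasible (realMat A) (realVec b)) ≤ bNorm B (x - 0) := bDist_le 0 hx
    _ ≤ √(sSup (spectrum ℝ B) * (x ⬝ᵥ x)) := by
        rw [sub_zero]; exact Real.sqrt_le_sqrt (le_sSup_spectrum_mul hB x)
    _ = √(sSup (spectrum ℝ B)) * √(x ⬝ᵥ x) := Real.sqrt_mul'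
        _ (Finset.sum_nonneg fun j _ => mul_self_nonneg _)
    _ ≤ √(sSup (spectrum ℝ B)) * (P * √n) := by
        gcongr
        rw [Real.sqrt_le_left (by positivity), mul_pow, Real.sq_sqrt hn'.le]
        linarith
    _ ≤ _ := by gcongr

/-! ### The probability bound -/

section Bound

lemma sqrt_pow_eq_rpow {r : ℝ} (hr : 0 ≤ r) (j : ℕ) : √(r ^ j) = r ^ ((j : ℝ) / 2) := by
  rw [Real.sqrt_eq_rpow, ← Real.rpow_natCast, ← Real.rpow_mul hr, mul_one_div]

/-- The range starts at 1 because for r = 0 the real power is 0 at exponent -1/2 but 1 at exponent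
0. -/
lemma boundH_antitoneOn {n : ℕ} {σ ξ ψ α r : ℝ} (hψ : 0 ≤ ψ) (hr0 : 0 ≤ r) (hr1 : r ≤ 1) :
    AntitoneOn (boundH n σ ξ ψ α r) (Set.Ici 1) := by
  intro a ha c _ hac
  have ha' : (1 : ℝ) ≤ a := by exact_mod_cast ha
  have hac' : (a : ℝ) ≤ c := by exact_mod_cast hac
  unfold boundH
  gcongr ?_ * ?_
  exact Real.rpow_le_rpow_of_exponent_ge' hr0 hr1 (by linarith) (by linarith)

lemma boundH_strictAnti {n : ℕ} {σ ξ ψ α r : ℝ} (hn : 0 < n) (hξ : 0 < ξ) (hα : 0 ≤ α)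
    (hψ : 0 < ψ) (hr0 : 0 < r) (hr1 : r < 1) : StrictAnti (boundH n σ ξ ψ α r) := by
  intro a c hac
  have hac' : (a : ℝ) < c := by exact_mod_cast hac
  have hn' : (0 : ℝ) < n := by exact_mod_cast hn
  unfold boundH
  exact mul_lt_mul_of_pos_left (Real.rpow_lt_rpow_of_exponent_gt hr0 hr1 (by linarith))
    (by positivity)

variable {m n q : ℕ} {A : Matrix (Fin m) (Fin n) ℚ} {b : Fin m → ℚ}
  {B : Matrix (Fin n) (Fin n) ℝ} {S : Fin q → Fin m → ℝ} {R : SamplingRule n q} {δ γ α r : ℝ}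

/-- A geometric bound on the expected distance bounds the failure probability of the next iterate. -/
lemma failProb_le_of_expStep [NeZero n] (hm : 0 < m)
    (hX : (feasible (realMat A) (realVec b)).Nonempty) (hB : B.PosDef) (hr : 0 ≤ r) {k j : ℕ}
    (h : (expStep (realMat A) (realVec b) B S R δ γ ^ k)
        (fun s => bDist B s.1 (feasible (realMat A) (realVec b))) (0, 0) ≤
      √((1 + α) * r ^ j) * bDist B 0 (feasible (realMat A) (realVec b))) :
    failProb A b B S R δ γ k ≤
      boundH n (encodingLength A b) (condNumber B) (maxRowNorm (realMat A)) α r (j + 1) := by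
  have : Nonempty (Fin m) := ⟨⟨0, hm⟩⟩
  set X := feasible (realMat A) (realVec b) with hXdef
  set σ := encodingLength A b with hσ
  set ψ := maxRowNorm (realMat A) with hψdef
  have hψ : 0 ≤ ψ := maxRowNorm_nonneg
  have hl := Real.sqrt_pos.2 (sInf_spectrum_pos hB)
  have hn' : (0 : ℝ) < n := by exact_mod_cast NeZero.pos n
  -- Chosen so that C·d_B ≥ 1 at every point that is not a certificate.
  set C := ψ / √(sInf (spectrum ℝ B)) / (2 : ℝ) ^ (1 - σ) with hC
  have hC0 : 0 ≤ C := by positivity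
  have hmarkov := iterateLaw_toReal_le (A := realMat A) (b := realVec b) (B := B) (S := S) (R := R)
    (δ := δ) (γ := γ) 0 k (U := {x | ¬ IsCertificate A b x}) (g := fun x => C * bDist B x X)
    (fun x => mul_nonneg hC0 (bDist_nonneg _ _)) (fun x hx => by
      have h1 : (2 : ℝ) ^ (1 - σ) ≤ maxViolation (realMat A) (realVec b) x := not_lt.1 hx
      rw [hC, div_mul_eq_mul_div, le_div_iff₀ (by positivity), one_mul]
      exact h1.trans (maxViolation_le hB hX x))
  have hlin : (expStep (realMat A) (realVec b) B S R δ γ ^ k) (fun s => C * bDist B s.1 X) (0, 0) =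
      C * (expStep (realMat A) (realVec b) B S R δ γ ^ k) (fun s => bDist B s.1 X) (0, 0) := by
    have := congrFun (map_smul (expStep (realMat A) (realVec b) B S R δ γ ^ k) C
      (fun s => bDist B s.1 X)) (0, 0)
    exact this
  rw [hlin] at hmarkov
  refine hmarkov.trans ?_
  have hd0 := bDist_zero_le hm A b hX hB
  calc C * (expStep (realMat A) (realVec b) B S R δ γ ^ k) (fun s => bDist B s.1 X) (0, 0)
      ≤ C * (√((1 + α) * r ^ j) *
          (√(sSup (spectrum ℝ B)) * ((2 : ℝ) ^ (σ - 1) / √n))) := by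
        gcongr
        exact h.trans (by gcongr)
    _ = boundH n σ (condNumber B) ψ α r (j + 1) := by
        -- One factor 2^(σ-1) comes from the initial distance, the other from the certificate
        -- threshold.
        have h2 : (2 : ℝ) ^ (2 * σ - 2) = (2 : ℝ) ^ (σ - 1) / (2 : ℝ) ^ (1 - σ) := by
          rw [← Real.rpow_sub two_pos]; congr 1; ring
        have hmax : 0 ≤ sSup (spectrum ℝ B) :=
          (sInf_spectrum_pos hB).le.trans (sInf_spectrum_le_sSup hB)
        have h3 : √(condNumber B * (1 + α) / n) =
            √(sSup (spectrum ℝ B)) / √(sInf (spectrum ℝ B)) * √(1 + α) / √n := by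
          rw [Real.sqrt_div' _ hn'.le, Real.sqrt_mul (condNumber_pos hB).le, condNumber,
            Real.sqrt_div hmax]
        rw [boundH, h2, h3, hC, Real.sqrt_mul' _ (pow_nonneg hr j), sqrt_pow_eq_rpow hr]
        push_cast
        rw [add_sub_cancel_right]
        ring

end Bound

lemma pow_le_sqrt_mul_pow {a α r : ℝ} (ha : a ^ 2 ≤ r) (hα : 0 ≤ α) (j : ℕ) :
    a ^ j ≤ √((1 + α) * r ^ j) := by
  apply Real.le_sqrt_of_sq_le
  rw [← pow_mul, mul_comm j, pow_mul]
  have h1 := pow_le_pow_left₀ (sq_nonneg a) ha j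
  have h2 : 0 ≤ r ^ j := (pow_nonneg (sq_nonneg a) j).trans h1
  nlinarith

end ASPM

end

/-! ### Assembly of the three parameter cases -/

theorem mainTheorem5 {m n q : ℕ} (hm : 0 < m)
    (A : Matrix (Fin m) (Fin n) ℚ) (b : Fin m → ℚ)
    (hA : ∀ i, A i ≠ 0)
    (hfeas : (ASPM.feasible (ASPM.realMat A) (ASPM.realVec b)).Nonempty)
    (B : Matrix (Fin n) (Fin n) ℝ) (hB : B.PosDef)
    (S : Fin q → Fin m → ℝ) (hS : ∀ i j, 0 ≤ S i j)
    (hAS : ∀ i, (ASPM.realMat A).transpose.mulVec (S i) ≠ 0)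
    (R : ASPM.SamplingRule n q)
    (μ₁ μ₂ : ℝ) (hμ₁ : 0 < μ₁)
    (hμ : ∀ x,
      μ₁ / 2 * ASPM.bDist B x (ASPM.feasible (ASPM.realMat A) (ASPM.realVec b)) ^ 2
          ≤ ASPM.expLoss (ASPM.realMat A) (ASPM.realVec b) B S R x ∧
        ASPM.expLoss (ASPM.realMat A) (ASPM.realVec b) B S R x
          ≤ μ₂ / 2 * ASPM.bDist B x (ASPM.feasible (ASPM.realMat A) (ASPM.realVec b)) ^ 2)
    (δ γ ζ α ρbar : ℝ)
    (hparam :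
      ((δ, γ) ∈ ASPM.setQ μ₁ μ₂ ∧ α = 0 ∧ ρbar = ASPM.rho2 μ₁ μ₂ δ γ ^ 2) ∨
      ((δ, γ, ζ) ∈ ASPM.setR ∩ ASPM.setS μ₁ μ₂ ∧
        (ASPM.IsGreedyRule (ASPM.realMat A) (ASPM.realVec b) B S R ∨
          ASPM.IsConvexRule (ASPM.realMat A) (ASPM.realVec b) B S R) ∧
        α = ASPM.alphaC μ₁ μ₂ δ γ ζ ∧ ρbar = ASPM.rhoC μ₁ μ₂ δ γ ζ) ∨
      ((δ, γ) ∈ ASPM.setQ μ₁ μ₂ ∧ (δ, γ, ζ) ∈ ASPM.setR ∩ ASPM.setS μ₁ μ₂ ∧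
        α = ASPM.alphaC μ₁ μ₂ δ γ ζ ∧
        ρbar = max (ASPM.rho2 μ₁ μ₂ δ γ ^ 2) (ASPM.rhoC μ₁ μ₂ δ γ ζ))) :
    0 ≤ α ∧ 0 ≤ ρbar ∧ ρbar < 1 ∧
    (∀ k : ℕ,
      ASPM.threshold n (ASPM.encodingLength A b) (ASPM.condNumber B)
          (ASPM.maxRowNorm (ASPM.realMat A)) α ρbar < (k : ℝ) - 1 →
      ASPM.failProb A b B S R δ γ k
        ≤ ASPM.boundH n (ASPM.encodingLength A b) (ASPM.condNumber B)
            (ASPM.maxRowNorm (ASPM.realMat A)) α ρbar k) ∧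
    AntitoneOn (ASPM.boundH n (ASPM.encodingLength A b) (ASPM.condNumber B)
      (ASPM.maxRowNorm (ASPM.realMat A)) α ρbar) (Set.Ici 1) ∧
    (0 < ρbar → StrictAnti (ASPM.boundH n (ASPM.encodingLength A b) (ASPM.condNumber B)
      (ASPM.maxRowNorm (ASPM.realMat A)) α ρbar)) := by
  have hn : n ≠ 0 := by
    rintro rfl
    exact hA ⟨0, hm⟩ (funext fun j => j.elim0)
  have : NeZero n := ⟨hn⟩
  have hrow : ∀ i, ASPM.realMat A i ≠ 0 := fun i h => hA i (funext fun j => by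
    simpa [ASPM.realMat] using congrFun h j)
  set X := ASPM.feasible (ASPM.realMat A) (ASPM.realVec b) with hX
  have hμ₂ : 0 < μ₂ := by
    obtain ⟨x, hx⟩ := ASPM.exists_bDist_pos hB hfeas ⟨0, hm⟩ (hrow _)
    have h1 := (hμ x).1.trans (hμ x).2
    have h2 := le_of_mul_le_mul_right h1 (pow_pos hx 2)
    linarith
  have hψ : 0 < ASPM.maxRowNorm (ASPM.realMat A) := ASPM.maxRowNorm_pos ⟨0, hm⟩ (hrow _)
  obtain ⟨hα, hρ0, hρ1, hexp⟩ : 0 ≤ α ∧ 0 ≤ ρbar ∧ ρbar < 1 ∧ ∀ j : ℕ,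
      (ASPM.expStep (ASPM.realMat A) (ASPM.realVec b) B S R δ γ ^ j)
        (fun s => ASPM.bDist B s.2 X) (0, 0) ≤
      √((1 + α) * ρbar ^ j) * ASPM.bDist B 0 X := by
    -- Stated for every a ≥ 0 and r ≥ ρ₂², so that it serves the first and third cases alike.
    have hQ : (δ, γ) ∈ ASPM.setQ μ₁ μ₂ → ASPM.rho2 μ₁ μ₂ δ γ ^ 2 < 1 ∧ ∀ {a r : ℝ}, 0 ≤ a →
        ASPM.rho2 μ₁ μ₂ δ γ ^ 2 ≤ r → ∀ j : ℕ,
        (ASPM.expStep (ASPM.realMat A) (ASPM.realVec b) B S R δ γ ^ j)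
          (fun s => ASPM.bDist B s.2 X) (0, 0) ≤ √((1 + a) * r ^ j) * ASPM.bDist B 0 X := by
      intro h
      have h0 : 0 ≤ ASPM.rho2 μ₁ μ₂ δ γ := ASPM.rho2_nonneg h.2.2.1
      refine ⟨pow_lt_one₀ h0 (ASPM.rho2_lt_one hμ₁ h) two_ne_zero, fun ha hr j => ?_⟩
      refine (ASPM.expStep_pow_bDist_le hB hS hAS hfeas hμ₂ hμ h 0 j).trans ?_
      exact mul_le_mul_of_nonneg_right (ASPM.pow_le_sqrt_mul_pow hr ha j) (ASPM.bDist_nonneg _ _)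
    rcases hparam with ⟨h, rfl, rfl⟩ | ⟨h, hrule, rfl, rfl⟩ | ⟨h, h', rfl, rfl⟩
    · exact ⟨le_rfl, sq_nonneg _, (hQ h).1, (hQ h).2 le_rfl le_rfl⟩
    · have hconv : ASPM.IsConvexRule (ASPM.realMat A) (ASPM.realVec b) B S R :=
        hrule.elim (fun hg => hg.isConvexRule hB hAS) id
      refine ⟨ASPM.alphaC_nonneg, ASPM.rhoC_nonneg h.1, ASPM.rhoC_lt_one hμ₁ h.1 h.2, fun j => ?_⟩
      rw [← Real.sqrt_sq (ASPM.bDist_nonneg (B := B) 0 X), ← Real.sqrt_mul' _ (sq_nonneg _)]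
      exact Real.le_sqrt_of_sq_le ((ASPM.sq_expStep_pow_le _ j _).trans
        (ASPM.expStep_pow_sq_bDist_le hB hS hAS hfeas hconv hμ₁ hμ₂ hμ h.1 h.2 0 j))
    · exact ⟨ASPM.alphaC_nonneg, (sq_nonneg _).trans (le_max_left _ _),
        max_lt (hQ h).1 (ASPM.rhoC_lt_one hμ₁ h'.1 h'.2),
        (hQ h).2 ASPM.alphaC_nonneg (le_max_left _ _)⟩
  have hanti : 0 < ρbar → StrictAnti (ASPM.boundH n (ASPM.encodingLength A b) (ASPM.condNumber B)
      (ASPM.maxRowNorm (ASPM.realMat A)) α ρbar) := fun h =>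
    ASPM.boundH_strictAnti (Nat.pos_of_ne_zero hn) (ASPM.condNumber_pos hB) hα hψ h hρ1
  refine ⟨hα, hρ0, hρ1, fun k hk => ?_, ASPM.boundH_antitoneOn hψ.le hρ0 hρ1.le, hanti⟩
  cases k with
  | zero =>
    have hpos : 0 < ρbar := by
      -- For ρbar = 0 the threshold evaluates to 0, which is not below k - 1 = -1. For ρbar > 0, x₀
      -- = x₁ in effect and H(1) ≤ H(0).
      refine hρ0.lt_of_ne fun h0 => ?_
      rw [← h0] at hk
      norm_num [ASPM.threshold] at hk
    refine (ASPM.failProb_le_of_expStep hm hfeas hB hρ0 (j := 0) ?_).trans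
      ((hanti hpos).antitone zero_le_one)
    simpa using hexp 0
  | succ j =>
    -- After j steps the second entry of the pair is x_(j+1), so the exponent is k - 1.
    refine ASPM.failProb_le_of_expStep hm hfeas hB hρ0 ?_
    rw [ASPM.expStep_pow_succ_apply, ASPM.expStep_fst fun x => ASPM.bDist B x X]
    exact hexp j
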